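/- Fix $s\in\mathbb C\setminus\{0\}$ and put $q=s^{-2}$. For $N\ge 0$ let $\mathcal P_N$ be the set of collections of $N$ up-right paths in $D_N=\mathbb Z_{\ge0}\times\{1,\dots,N\}$, no two sharing a horizontal or vertical edge, one path entering each row $j$ through the edge $(-1,j)\to(0,j)$, and all paths leaving through the top boundary (a collection is identified with the set of edges it uses). For $\omega\in\mathcal P_N$ let $\omega(i,j)=(i_1,j_1;i_2,j_2)$ be the numbers of arrows entering the vertex $(i,j)$ from below and from the left, and leaving it upwards and to the right, and let $\lambda^k(\omega)=(\lambda^k_1\ge\dots\ge\lambda^k_k\ge 0)$ be the ordered $x$-coordinates of the intersections of $\omega$ with the line $y=k+\tfrac12$. Put $$w_u(0,0;0,0)=1,\quad w_u(1,0;1,0)=\tfrac{1-s^{-1}u}{1-su},\quad w_u(1,0;0,1)=\tfrac{(1-s^2)u}{1-su},$$ $$w_u(0,1;1,0)=\tfrac{1-s^{-2}}{1-su},\quad w_u(0,1;0,1)=\tfrac{u-s}{1-su},\quad w_u(1,1;1,1)=\tfrac{u-s^{-1}}{1-su},$$ and $w_u=0$ otherwise. Let $\mathsf{Sign}^+_N$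 be the set of integer sequences $\lambda_1\ge\dots\ge\lambda_N\ge0$. For $f:\mathsf{Sign}^+_N\to\mathbb R$ and ${\bf z}=(z_1,\dots,z_N)\in\mathbb C^N$ let $$\mathcal W^f(\omega;{\bf z})=\prod_{i=0}^\infty\prod_{j=1}^N w_{z_j}(\omega(i,j))\cdot f(\lambda^N(\omega)).$$ For integers ${\bf m}=(m_1,\dots,m_k)$, $k\ge0$, let $A({\bf m})$ be the set of $\omega\in\mathcal P_N$ such that for every $i=1,\dots,k$ the signature $\lambda^{m_i}(\omega)$ has distinct parts and its last $i$ parts are $\lambda^{m_i}_{m_i}=0,\ \lambda^{m_i}_{m_i-1}=1,\dots,\lambda^{m_i}_{m_i-i+1}=i-1$ (this is impossible if $m_i<i$), and let $\mathcal W^f({\bf m};{\bf z})=\sum_{\omega\in A({\bf m})}\mathcal W^f(\omega;{\bf z})$. **Lemma.** Let $N\ge1$, $1\le k\le N$, $1\le m_1\le\dots\le m_k\le N$ and $f:\mathsf{Sign}^+_N\to\mathbb R$. Let $U\subset\mathbb C^N$ be an open set such that the weights $\mathcal W^f(\omega;{\bf z})$, $\omega\in\mathcal P_N$, are absolutely summable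 for every ${\bf z}\in U$. Put $\hat{\bf m}=(m_2-1,\dots,m_k-1)$, let ${\bf z}/\{z_i\}=(z_1,\dots,z_{i-1},z_{i+1},\dots,z_N)$, and let $g:\mathsf{Sign}^+_{N-1}\to\mathbb R$, $g(\mu)=f(\mu_1+1,\dots,\mu_{N-1}+1,0)$. Then for every ${\bf z}\in U$ with pairwise distinct coordinates and $sz_j\ne1$ for all $j$, the weights $\mathcal W^g(\omega;{\bf z}/\{z_i\})$, $\omega\in\mathcal P_{N-1}$, are absolutely summable for each $i\le m_1$, and $$\mathcal W^f({\bf m};{\bf z})=\prod_{j=m_1+1}^N\frac{z_j-sq}{1-sz_j}\ \sum_{i=1}^{m_1}\frac{1-q}{1-sz_i}\prod_{\substack{j=1\\ j\ne i}}^{m_1}\left(\frac{z_j-qz_i}{z_j-z_i}\,\frac{z_j-s}{1-sz_j}\right)\mathcal W^g(\hat{\bf m};{\bf z}/\{z_i\}).$$ -/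

import Mathlib

open scoped BigOperators Topology

noncomputable section

/-- Nonnegative signatures of length `k`: sequences `λ₁ ≥ λ₂ ≥ ⋯ ≥ λ_k ≥ 0` of integers.
The part `λ_{i+1}` is the value at `i : Fin k`. -/
abbrev SignPos (k : ℕ) : Type := {l : Fin k → ℕ // Antitone l}

/-- Signatures with distinct parts. -/
def signStar (m : ℕ) : Set (SignPos m) := {l | StrictAnti l.1}

/-- Signatures `l` of length `m` with distinct parts and `l_m = 0, l_{m-1} = 1, …, l_{m-r+1} = r-1`.
(`Fin.rev ⟨j, h⟩` is the zero-based index of the part `l_{m-j}`.) All the parts named have to exist,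
so the set is empty for `m < r`. -/
def signStarR (m r : ℕ) : Set (SignPos m) :=
  {l | l ∈ signStar m ∧ ∀ j < r, ∃ h : j < m, l.1 (Fin.rev ⟨j, h⟩) = j}

/-- `μ ↦ μ + 1^n`: the signature `(μ₁ + 1, …, μ_n + 1, 0)` of length `n + 1`. -/
def SignPos.addOnes {n : ℕ} (l : SignPos n) : SignPos (n + 1) :=
  ⟨Fin.snoc (α := fun _ => ℕ) (fun i => l.1 i + 1) 0, by
    intro i j hij
    induction j using Fin.lastCases with
    | last => simp
    | cast j =>
      induction i using Fin.lastCases with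
      | last => exact absurd hij (not_le.mpr (Fin.castSucc_lt_last j))
      | cast i => simpa using l.2 (Fin.castSucc_le_castSucc_iff.mp hij)⟩

/-- Collections of `N` up-right paths in `ℤ_{≥0} × {1, …, N}`, no two sharing an edge, one entering
each row through the left boundary and all leaving through the top boundary, recorded by the edges
that they use. Row `j + 1` of the strip is `j : Fin N`.

`horiz x j` says whether the edge `(x - 1, j + 1) → (x, j + 1)` is used, and
`vert x k` whether the edge `(x, k) → (x, k + 1)` is used. -/
@[ext]
structure PathConfig (N : ℕ) where
  horiz : ℕ → Fin N → Bool
  vert : ℕ → Fin (N + 1) → Bool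
  /-- an arrow enters every row from the left -/
  left : ∀ j, horiz 0 j = true
  /-- no arrow enters from the bottom -/
  bottom : ∀ x, vert x 0 = false
  /-- as many arrows leave a vertex as enter it -/
  conserve : ∀ x j, (vert x j.castSucc).toNat + (horiz x j).toNat
    = (vert x j.succ).toNat + (horiz (x + 1) j).toNat
  /-- no arrow propagates to infinity on the right -/
  bounded : ∃ X, ∀ x, X ≤ x → ∀ j, horiz x j = false

namespace PathConfig

variable {N : ℕ}

theorem vert_eq_false (ω : PathConfig N) {X : ℕ} (hX : ∀ x, X ≤ x → ∀ j, ω.horiz x j = false)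
    {x : ℕ} (hx : X ≤ x) (k : Fin (N + 1)) : ω.vert x k = false := by
  induction k using Fin.induction with
  | zero => exact ω.bottom x
  | succ j ih =>
    have h := ω.conserve x j
    rw [ih, hX x hx j, hX (x + 1) (by omega) j] at h
    revert h
    cases ω.vert x j.succ <;> simp

theorem finite_vert (ω : PathConfig N) (k : Fin (N + 1)) : {x | ω.vert x k = true}.Finite := by
  obtain ⟨X, hX⟩ := ω.bounded
  refine (Set.finite_lt_nat X).subset fun x hx => ?_
  by_contra h
  have := ω.vert_eq_false hX (not_lt.mp h) k
  simp_all

/-- The `x`-coordinates of the intersections of the paths with the line `y = k + 1/2`. -/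
def columns (ω : PathConfig N) (k : Fin (N + 1)) : Finset ℕ := (ω.finite_vert k).toFinset

theorem card_columns (ω : PathConfig N) (k : Fin (N + 1)) : (ω.columns k).card = k := by
  obtain ⟨X, hX⟩ := ω.bounded
  have key : ∀ k, (ω.columns k).card = ∑ x ∈ Finset.range X, (ω.vert x k).toNat := by
    intro k
    have h1 : ω.columns k = (Finset.range X).filter fun x => ω.vert x k = true := by
      ext x
      simp only [columns, Set.Finite.mem_toFinset, Set.mem_ofPred_eq, Finset.mem_filter,
        Finset.mem_range]
      refine ⟨fun h => ⟨?_, h⟩, fun h => h.2⟩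
      by_contra hx
      have := ω.vert_eq_false hX (not_lt.mp hx) k
      simp_all
    rw [h1, Finset.card_filter]
    exact Finset.sum_congr rfl fun x _ => by cases ω.vert x k <;> rfl
  rw [key]
  induction k using Fin.induction with
  | zero => simp [ω.bottom]
  | succ j ih =>
    have h := Finset.sum_congr (rfl : Finset.range X = _) fun x _ => ω.conserve x j
    rw [Finset.sum_add_distrib, Finset.sum_add_distrib, ih] at h
    have h2 := Finset.sum_range_succ (fun x => (ω.horiz x j).toNat) X
    rw [Finset.sum_range_succ'] at h2
    simp only [ω.left j, hX X le_rfl j, Bool.toNat_true, Bool.toNat_false] at h2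
    simp only [Fin.val_castSucc] at h
    simp only [Fin.val_succ]
    omega

/-- The signature `λ^k(ω)`: the `x`-coordinates of the intersections of the paths with the line
`y = k + 1/2`, in decreasing order. -/
def sig (ω : PathConfig N) (k : Fin (N + 1)) : SignPos k :=
  ⟨fun i => (ω.columns k).orderEmbOfFin (ω.card_columns k) (Fin.rev i), fun _ _ hij =>
    ((ω.columns k).orderEmbOfFin (ω.card_columns k)).monotone (Fin.rev_le_rev.mpr hij)⟩

end PathConfig

/-- The six-vertex weight `w_u(i₁, j₁; i₂, j₂)`: arrows coming from the bottom and the left, and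
leaving from the top and the right. -/
def vertexWeight (s u : ℂ) : Bool → Bool → Bool → Bool → ℂ
  | false, false, false, false => 1
  | true, false, true, false => (1 - s⁻¹ * u) / (1 - s * u)
  | true, false, false, true => (1 - s ^ 2) * u / (1 - s * u)
  | false, true, true, false => (1 - (s ^ 2)⁻¹) / (1 - s * u)
  | false, true, false, true => (u - s) / (1 - s * u)
  | true, true, true, true => (u - s⁻¹) / (1 - s * u)
  | _, _, _, _ => 0

/-- The weight `𝒲^f(ω; z)` of a path collection. All but finitely many columns are empty and
contribute the factor `1`. -/
def pathWeight {N : ℕ} (s : ℂ) (f : SignPos N → ℝ) (z : Fin N → ℂ) (ω : PathConfig N) : ℂ :=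
  (∏ᶠ x : ℕ, ∏ j : Fin N, vertexWeight s (z j)
    (ω.vert x j.castSucc) (ω.horiz x j) (ω.vert x j.succ) (ω.horiz (x + 1) j))
  * (f (ω.sig (Fin.last N)) : ℂ)

/-- The set `A(m₁, …, m_k)` of path collections with `λ^{m_i}(ω)` in `signStarR m_i i` for
`i = 1, …, k`; here `m_{i+1}` is the value of `m` at `i : Fin k`. -/
def obsEvent (N : ℕ) {k : ℕ} (m : Fin k → ℕ) : Set (PathConfig N) :=
  {ω | ∀ i, ∃ h : m i < N + 1, ω.sig ⟨m i, h⟩ ∈ signStarR (m i) (i + 1)}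

/-- The observable `𝒲^f(m; z)`. -/
def obsWeight {N k : ℕ} (s : ℂ) (f : SignPos N → ℝ) (m : Fin k → ℕ) (z : Fin N → ℂ) : ℂ :=
  ∑' ω : obsEvent N m, pathWeight s f z ω.1

end

/-! An arrow enters every row from the left, and a vertex with arrows from below and from the left
can only let both go straight on. So column 0, once occupied, stays occupied. The event requires it
to be occupied at height `m 0`. In the rows above that height, column 0 contributes the factor `(z j
- s⁻¹) / (1 - s * z j)`, where `s⁻¹ = s * q`, and hands the arrow of the row on to column 1. In the
rows below, exactly one arrow turns up in column 0, and its row enters the other columns without an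
arrow.

Let A(u) and B(u) be the transfer matrices of a row with left input `false` and `true` (`rowOp`).
Below height `m 0` the columns from 1 on then see a product of B's with a single A among them. The
Yang–Baxter equation (`yang_baxter`, lifted to rows in `rowOp_exchange`) gives the commutation
relations of A and B, and A fixes the vacuum. Moving A down to the vacuum, as in the algebraic Bethe
ansatz (`rowOp_false_mulVec_freeLayer`), produces products of B's with one row missing. Summing over
the row of the turn gives the coefficients `removalCoeff` (`freeLayer_cons_true`). Removing column 0
and one row lowers all heights and columns in the event by one (`layer_cons_true`), and the
condition at `m 0` disappears.

These identities are finite: for a fixed top signature only finitely many columns matter. The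
observables are then sums of the finite partition functions against `f`, which needs absolute
convergence for the smaller system. That follows by domination: a collection on `n` rows is extended
by a path through one more row and one more column, at the cost of a constant independent of the
number of columns (`exists_layer_le_cons_true`). The extension needs nonzero weights. This fails if
a coordinate equals `s`, so the comparison is made at a nearby point of the open set `U`. It also
fails if `s ^ 2 = 1`, but then every positive number of rows has total weight zero. -/

/-- Occupation states of `L` columns. -/
abbrev RowState (L : ℕ) : Type := Fin L → Bool

/-! ### Row-by-row transfer and conservation of arrows -/

section Transfer

variable {R : Type*} [CommSemiring R]

/-- The weight of a row of `L` vertices with left input `l` and no output on the right, between the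
state `σ` below and the state `τ` above. -/
def rowWeight (w : Bool → Bool → Bool → Bool → R) :
    (L : ℕ) → Bool → RowState L → RowState L → R
  | 0, l, _, _ => if l then 0 else 1
  | L + 1, l, σ, τ =>
    ∑ c, w (σ 0) l (τ 0) c * rowWeight w L c (Fin.tail σ) (Fin.tail τ)

theorem rowWeight_cons (w : Bool → Bool → Bool → Bool → R) {L : ℕ} (l a b : Bool)
    (σ τ : RowState L) :
    rowWeight w (L + 1) l (Fin.cons a σ : RowState (L + 1)) (Fin.cons b τ : RowState (L + 1)) =
      ∑ c, w a l b c * rowWeight w L c σ τ := by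
  simp [rowWeight]

open Classical in
/-- The partition function of `k` rows with an arrow entering each row from the left, with top state
`τ`, restricted to the states at height `j` lying in `E j`. -/
noncomputable def layer {L : ℕ} (w : ℕ → Bool → Bool → Bool → Bool → R)
    (E : ℕ → Set (RowState L)) : ℕ → RowState L → R
  | 0, τ => if τ ∈ E 0 ∧ τ = fun _ => false then 1 else 0
  | k + 1, τ => if τ ∈ E (k + 1) then ∑ σ, rowWeight (w k) L true σ τ * layer w E k σ else 0

/-- Vanishing of the weights that violate the conservation of arrows. -/
def Conservative (w : Bool → Bool → Bool → Bool → R) : Prop :=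
  ∀ a b c d : Bool, a.toNat + b.toNat ≠ c.toNat + d.toNat → w a b c d = 0

/-- Conservation determines the horizontal edges from left to right, so the sum over internal edges
has at most one nonzero term. -/
theorem rowWeight_eq_prod {w : Bool → Bool → Bool → Bool → R} (hw : Conservative w) {L : ℕ}
    (h : ℕ → Bool) (hL : h L = false) (σ τ : RowState L)
    (hc : ∀ x : Fin L, (σ x).toNat + (h x).toNat = (τ x).toNat + (h (x + 1)).toNat) :
    rowWeight w L (h 0) σ τ = ∏ x : Fin L, w (σ x) (h x) (τ x) (h (x + 1)) := by
  induction L generalizing h with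
  | zero => simp [rowWeight, hL]
  | succ L ih =>
    rw [rowWeight, Finset.sum_eq_single (h 1), Fin.prod_univ_succ]
    · have := ih (fun x => h (x + 1)) hL (Fin.tail σ) (Fin.tail τ)
        fun x => by simpa [Fin.tail] using hc x.succ
      simp only [Fin.val_zero, Fin.val_succ, zero_add] at this ⊢
      rw [this]
      rfl
    · intro c _ hne
      rw [hw, zero_mul]
      have h0 := hc 0
      simp only [Fin.val_zero, zero_add] at h0
      rw [h0]
      revert hne
      cases c <;> cases h 1 <;> simp
    · simp

theorem exists_of_rowWeight_ne_zero {w : Bool → Bool → Bool → Bool → R} (hw : Conservative w)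
    {L : ℕ} {l : Bool} {σ τ : RowState L} (h : rowWeight w L l σ τ ≠ 0) :
    ∃ h : ℕ → Bool, h 0 = l ∧ (∀ x, L ≤ x → h x = false) ∧
      ∀ x : Fin L, (σ x).toNat + (h x).toNat = (τ x).toNat + (h (x + 1)).toNat := by
  induction L generalizing l with
  | zero =>
    cases l
    · exact ⟨fun _ => false, rfl, fun _ _ => rfl, fun x => x.elim0⟩
    · simp [rowWeight] at h
  | succ L ih =>
    obtain ⟨c, -, hc⟩ := Finset.exists_ne_zero_of_sum_ne_zero h
    obtain ⟨g, g0, gL, gc⟩ := ih (right_ne_zero_of_mul hc)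
    refine ⟨fun x => x.casesOn l g, rfl, ?_, ?_⟩
    · rintro (_ | x) hx
      · omega
      · exact gL x (by omega)
    · refine Fin.cases ?_ fun x => ?_
      · by_contra hne
        exact left_ne_zero_of_mul hc (hw _ _ _ _ (by simpa [g0] using hne))
      · simpa [Fin.tail] using gc x

theorem sum_rowState_succ {M : Type*} [AddCommMonoid M] {L : ℕ} (F : RowState (L + 1) → M) :
    ∑ σ, F σ = ∑ a, ∑ σ : RowState L, F (Fin.cons a σ : RowState (L + 1)) := by
  rw [← (Fin.consEquiv fun _ : Fin (L + 1) => Bool).sum_comp, Fintype.sum_prod_type]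
  rfl

end Transfer

/-! ### Path collections and the transfer recursion -/

namespace PathConfig

variable {N : ℕ}

/-- The state of the first `L` columns at height `k + 1/2`. -/
def state (L : ℕ) (ω : PathConfig N) (k : Fin (N + 1)) : RowState L := fun x => ω.vert x k

/-- Removing the top row. -/
def dropTop (ω : PathConfig (N + 1)) : PathConfig N where
  horiz x j := ω.horiz x j.castSucc
  vert x k := ω.vert x k.castSucc
  left _ := ω.left _
  bottom x := ω.bottom x
  conserve x j := ω.conserve x j.castSucc
  bounded := ω.bounded.imp fun _ h x hx _ => h x hx _

/-- Adding a top row. -/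
def addTop (ω : PathConfig N) (h t : ℕ → Bool) (h0 : h 0 = true)
    (hc : ∀ x, (ω.vert x (Fin.last N)).toNat + (h x).toNat = (t x).toNat + (h (x + 1)).toNat)
    (hb : ∃ X, ∀ x, X ≤ x → h x = false) : PathConfig (N + 1) where
  horiz x := Fin.snoc (α := fun _ => Bool) (ω.horiz x) (h x)
  vert x := Fin.snoc (α := fun _ => Bool) (ω.vert x) (t x)
  left j := by
    induction j using Fin.lastCases with
    | last => simpa using h0
    | cast j => simpa using ω.left j
  bottom x := by
    have : (0 : Fin (N + 1 + 1)) = Fin.castSucc 0 := rfl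
    rw [this, Fin.snoc_castSucc]
    exact ω.bottom x
  conserve x j := by
    induction j using Fin.lastCases with
    | last => rw [Fin.succ_last]; simpa using hc x
    | cast j => simpa [Fin.succ_castSucc, -Fin.castSucc_succ] using ω.conserve x j
  bounded := by
    obtain ⟨X, hX⟩ := hb
    obtain ⟨Y, hY⟩ := ω.bounded
    refine ⟨max X Y, fun x hx j => ?_⟩
    induction j using Fin.lastCases with
    | last => simpa using hX x (le_trans (le_max_left _ _) hx)
    | cast j => simpa using hY x (le_trans (le_max_right _ _) hx) j

theorem dropTop_addTop (ω : PathConfig N) (h t : ℕ → Bool) (h0 hc hb) :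
    (ω.addTop h t h0 hc hb).dropTop = ω := by
  ext <;> simp [addTop, dropTop]

/-- Path collections that leave the strip through the first `L` columns. -/
def within (N L : ℕ) : Set (PathConfig N) :=
  {ω | ∀ x, L ≤ x → ω.vert x (Fin.last N) = false}

/-- Surjectivity needed for the recursion on rows: a nonzero row weight supplies the horizontal
edges of a new top row. -/
theorem exists_dropTop_eq {R : Type*} [CommSemiring R] {w : Bool → Bool → Bool → Bool → R}
    (hw : Conservative w) {L : ℕ} {ω : PathConfig N} (hω : ω ∈ within N L) {τ : RowState L}
    (h : rowWeight w L true (ω.state L (Fin.last N)) τ ≠ 0) :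
    ∃ ω' ∈ within (N + 1) L, ω'.state L (Fin.last _) = τ ∧ ω'.dropTop = ω := by
  obtain ⟨h, h0, hL, hc⟩ := exists_of_rowWeight_ne_zero hw h
  refine ⟨ω.addTop h (fun x => if hx : x < L then τ ⟨x, hx⟩ else false) h0 (fun x => ?_) ⟨L, hL⟩,
    fun x hx => by simp [addTop, not_lt.mpr hx], ?_, dropTop_addTop _ _ _ _ _ _⟩
  · by_cases hx : x < L
    · simpa [hx, state] using hc ⟨x, hx⟩
    · simp [hx, hL x (by omega), hL (x + 1) (by omega), hω x (by omega)]
  · funext x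
    simp [state, addTop]

/-- A horizontal arrow in the top row beyond the last exit could never turn up and would run to
infinity, against `bounded`. -/
theorem horiz_last_eq_false {L : ℕ} {ω : PathConfig (N + 1)} (hω : ω ∈ within (N + 1) L) {x : ℕ}
    (hx : L ≤ x) : ω.horiz x (Fin.last N) = false := by
  obtain ⟨X, hX⟩ := ω.bounded
  have key : ∀ d x, L ≤ x → ω.horiz (x + d) (Fin.last N) = false →
      ω.horiz x (Fin.last N) = false := by
    intro d
    induction d with
    | zero => exact fun x _ h => h
    | succ d ih =>
      intro x hx h
      have h1 := ih (x + 1) (by omega) (by rwa [show x + 1 + d = x + (d + 1) by omega])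
      have h2 := ω.conserve x (Fin.last N)
      rw [h1, Fin.succ_last, hω x hx] at h2
      revert h2
      cases ω.horiz x (Fin.last N) <;> simp
  exact key X x hx (hX _ (by omega) _)

theorem dropTop_mem_within {L : ℕ} {ω : PathConfig (N + 1)} (hω : ω ∈ within (N + 1) L) :
    ω.dropTop ∈ within N L := by
  intro x hx
  have h2 := ω.conserve x (Fin.last N)
  rw [Fin.succ_last, hω x hx, horiz_last_eq_false hω hx, horiz_last_eq_false hω (by omega)] at h2
  change ω.vert x (Fin.last N).castSucc = false
  revert h2
  cases ω.vert x (Fin.last N).castSucc <;> simp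

theorem eq_of_dropTop_eq {ω ω' : PathConfig (N + 1)} (h : ω.dropTop = ω'.dropTop)
    (ht : ∀ x, ω.vert x (Fin.last _) = ω'.vert x (Fin.last _)) : ω = ω' := by
  have hv : ω.vert = ω'.vert := by
    funext x k
    induction k using Fin.lastCases with
    | last => exact ht x
    | cast k => exact congrFun (congrFun (congrArg PathConfig.vert h) x) k
  have hh : ω.horiz = ω'.horiz := by
    funext x j
    induction j using Fin.lastCases with
    | last =>
      induction x with
      | zero => rw [ω.left, ω'.left]
      | succ x ih =>
        have h1 := ω.conserve x (Fin.last N)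
        have h2 := ω'.conserve x (Fin.last N)
        rw [hv, ih, h2] at h1
        revert h1
        cases ω.horiz (x + 1) (Fin.last N) <;> cases ω'.horiz (x + 1) (Fin.last N) <;> simp
    | cast j => exact congrFun (congrFun (congrArg PathConfig.horiz h) x) j
  exact PathConfig.ext hh hv

instance : Subsingleton (PathConfig 0) where
  allEq ω ω' := by
    apply PathConfig.ext
    · funext x j
      exact j.elim0
    · funext x k
      have hk : k = 0 := Fin.ext (by omega)
      rw [hk, ω.bottom, ω'.bottom]

theorem finite_within (N L : ℕ) : (within N L).Finite := by
  induction N with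
  | zero => exact Set.toFinite _
  | succ N ih =>
    refine Set.Finite.of_injOn (f := fun ω => (ω.dropTop, ω.state L (Fin.last _)))
      (t := within N L ×ˢ Set.univ) (fun ω hω => ⟨dropTop_mem_within hω, trivial⟩) ?_
      (ih.prod Set.finite_univ)
    intro ω hω ω' hω' h
    simp only [Prod.mk.injEq] at h
    refine eq_of_dropTop_eq h.1 fun x => ?_
    by_cases hx : x < L
    · exact congrFun h.2 ⟨x, hx⟩
    · rw [hω x (by omega), hω' x (by omega)]

/-- The product of the vertex weights over the first `L` columns. -/
def weightProd {R : Type*} [CommSemiring R] (L : ℕ) (w : ℕ → Bool → Bool → Bool → Bool → R)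
    (ω : PathConfig N) : R :=
  ∏ j : Fin N, ∏ x : Fin L,
    w j (ω.vert x j.castSucc) (ω.horiz x j) (ω.vert x j.succ) (ω.horiz (x + 1) j)

theorem weightProd_succ {R : Type*} [CommSemiring R] {L : ℕ}
    {w : ℕ → Bool → Bool → Bool → Bool → R} (hw : ∀ j, Conservative (w j))
    {ω : PathConfig (N + 1)} (hω : ω ∈ within (N + 1) L) :
    ω.weightProd L w = ω.dropTop.weightProd L w *
      rowWeight (w N) L true (ω.dropTop.state L (Fin.last _)) (ω.state L (Fin.last _)) := by
  rw [weightProd, Fin.prod_univ_castSucc]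
  have := rowWeight_eq_prod (hw N) (fun x => ω.horiz x (Fin.last N))
    (horiz_last_eq_false hω le_rfl) (ω.dropTop.state L (Fin.last _)) (ω.state L (Fin.last _))
    fun x => ω.conserve x (Fin.last N)
  rw [ω.left] at this
  rw [this]
  rfl

-- Bridge from path collections to transfer matrices. Collections are grouped by what remains after
-- the top row is dropped; the dropped row contributes exactly the factor `rowWeight`.
open Classical in
theorem sum_weightProd_eq_layer {R : Type*} [CommSemiring R] {L : ℕ}
    {w : ℕ → Bool → Bool → Bool → Bool → R} (hw : ∀ j, Conservative (w j))
    (E : ℕ → Set (RowState L)) (N : ℕ) (τ : RowState L) :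
    ∑ ω ∈ (finite_within N L).toFinset with
        ω.state L (Fin.last N) = τ ∧ ∀ k : Fin (N + 1), ω.state L k ∈ E k,
      ω.weightProd L w = layer w E N τ := by
  induction N generalizing τ with
  | zero =>
    let ω₀ : PathConfig 0 :=
      ⟨fun _ j => j.elim0, fun _ _ => false, fun j => j.elim0, fun _ => rfl, fun _ j => j.elim0,
        0, fun _ _ j => j.elim0⟩
    have h1 : (finite_within 0 L).toFinset = {ω₀} := by
      ext ω
      simp only [Set.Finite.mem_toFinset, Finset.mem_singleton, Subsingleton.elim ω ω₀, iff_true]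
      exact fun _ _ => rfl
    have h2 : ∀ k, ω₀.state L k = fun _ => false := fun k => rfl
    rw [h1, Finset.sum_filter, Finset.sum_singleton, layer]
    have h3 : (ω₀.state L (Fin.last 0) = τ ∧ ∀ k : Fin (0 + 1), ω₀.state L k ∈ E k) ↔
        (τ ∈ E 0 ∧ τ = fun _ => false) := by
      simp only [h2]
      constructor
      · rintro ⟨rfl, h⟩
        exact ⟨h 0, rfl⟩
      · rintro ⟨h, rfl⟩
        refine ⟨rfl, fun k => ?_⟩
        rwa [show (k : ℕ) = 0 by omega]
    rw [if_congr h3 rfl rfl]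
    simp [weightProd]
  | succ N ih =>
    rw [layer]
    split_ifs with hE
    · have h1 : ∀ σ, rowWeight (w N) L true σ τ * layer w E N σ =
          ∑ ω ∈ {ω ∈ (finite_within N L).toFinset | ∀ k : Fin (N + 1), ω.state L k ∈ E k} with
            ω.state L (Fin.last N) = σ,
            ω.weightProd L w * rowWeight (w N) L true (ω.state L (Fin.last N)) τ := by
        intro σ
        rw [← ih, Finset.mul_sum]
        refine Finset.sum_congr (by ext; simp only [Finset.mem_filter]; tauto) fun ω hω => ?_
        rw [(Finset.mem_filter.mp hω).2, mul_comm]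
      simp_rw [h1]
      rw [Finset.sum_fiberwise]
      refine Finset.sum_of_injOn dropTop ?_ ?_ ?_ ?_
      · intro ω hω ω' hω' h
        simp only [Finset.coe_filter, Set.Finite.mem_toFinset] at hω hω'
        refine eq_of_dropTop_eq h fun x => ?_
        by_cases hx : x < L
        · exact congrFun (hω.2.1.trans hω'.2.1.symm) ⟨x, hx⟩
        · rw [hω.1 x (by omega), hω'.1 x (by omega)]
      · intro ω hω
        simp only [Finset.coe_filter, Set.Finite.mem_toFinset] at hω ⊢
        exact ⟨dropTop_mem_within hω.1, fun k => hω.2.2 k.castSucc⟩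
      · intro ω hω hne
        simp only [Finset.mem_filter, Set.Finite.mem_toFinset] at hω
        by_contra h0
        obtain ⟨ω', hω', ht, rfl⟩ := exists_dropTop_eq (hw N) hω.1 (right_ne_zero_of_mul h0)
        refine hne ⟨ω', ?_, rfl⟩
        simp only [Finset.coe_filter, Set.Finite.mem_toFinset]
        refine ⟨hω', ht, fun k => ?_⟩
        induction k using Fin.lastCases with
        | last => rw [ht]; exact hE
        | cast k => exact hω.2 k
      · intro ω hω
        simp only [Finset.mem_filter, Set.Finite.mem_toFinset] at hω
        rw [weightProd_succ hw hω.1, hω.2.1]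
    · refine Finset.sum_eq_zero fun ω hω => ?_
      rw [Finset.mem_filter] at hω
      exact absurd (hω.2.1 ▸ hω.2.2 (Fin.last _)) hE

end PathConfig

/-! ### The Yang–Baxter equation and the relations between row operators -/

section YangBaxter

theorem vertexWeight_conservative (s u : ℂ) : Conservative (vertexWeight s u) := by
  intro a b c d h
  cases a <;> cases b <;> cases c <;> cases d <;> simp [vertexWeight] at h ⊢

/-- The matrix intertwining two rows with parameters `u` and `v`. -/
noncomputable def crossWeight (q u v : ℂ) : Bool → Bool → Bool → Bool → ℂ
  | false, false, false, false => u - q * v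
  | true, true, true, true => u - q * v
  | true, false, true, false => u - v
  | true, false, false, true => (1 - q) * v
  | false, true, false, true => q * (u - v)
  | false, true, true, false => (1 - q) * u
  | _, _, _, _ => 0

/-- A finite check: each of the 64 boundary conditions gives an identity of rational functions. -/
theorem yang_baxter {s u v : ℂ} (hs : s ≠ 0) (hu : 1 - s * u ≠ 0) (hv : 1 - s * v ≠ 0)
    (l₁ l₂ a b c₁ c₂ : Bool) :
    ∑ k, ∑ e₁, ∑ e₂, vertexWeight s v a l₂ k e₂ * vertexWeight s u k l₁ b e₁ *
        crossWeight (s ^ 2)⁻¹ u v e₁ e₂ c₁ c₂ =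
      ∑ k, ∑ f₁, ∑ f₂, crossWeight (s ^ 2)⁻¹ u v l₁ l₂ f₁ f₂ * vertexWeight s u a f₁ k c₁ *
        vertexWeight s v k f₂ b c₂ := by
  have hu' : 1 - u * s ≠ 0 := by rwa [mul_comm]
  have hv' : 1 - v * s ≠ 0 := by rwa [mul_comm]
  simp only [Fintype.sum_bool]
  cases l₁ <;> cases l₂ <;> cases a <;> cases b <;> cases c₁ <;> cases c₂ <;>
    simp only [vertexWeight, crossWeight, mul_zero, zero_mul, add_zero, zero_add, mul_one,
      one_mul] <;> (try field_simp) <;> (try ring)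

/-- The row transfer matrix with left input `l` and no output on the right. -/
noncomputable def rowOp (s : ℂ) (L : ℕ) (l : Bool) (u : ℂ) : Matrix (RowState L) (RowState L) ℂ :=
  Matrix.of fun τ σ => rowWeight (vertexWeight s u) L l σ τ

theorem rowOp_cons (s : ℂ) {L : ℕ} (l : Bool) (u : ℂ) (a b : Bool) (σ τ : RowState L) :
    rowOp s (L + 1) l u (Fin.cons b τ : RowState (L + 1)) (Fin.cons a σ : RowState (L + 1)) =
      ∑ c, vertexWeight s u a l b c * rowOp s L c u τ σ :=
  rowWeight_cons _ _ _ _ _ _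

theorem rowOp_mul_rowOp_cons (s : ℂ) {L : ℕ} (l₁ l₂ : Bool) (u v : ℂ) (a b : Bool)
    (σ τ : RowState L) :
    (rowOp s (L + 1) l₁ u * rowOp s (L + 1) l₂ v) (Fin.cons b τ : RowState (L + 1))
        (Fin.cons a σ : RowState (L + 1)) =
      ∑ k, ∑ e₁, ∑ e₂, vertexWeight s v a l₂ k e₂ * vertexWeight s u k l₁ b e₁ *
        (rowOp s L e₁ u * rowOp s L e₂ v) τ σ := by
  rw [Matrix.mul_apply, sum_rowState_succ]
  refine Finset.sum_congr rfl fun k _ => ?_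
  simp only [rowOp_cons, Matrix.mul_apply, Fintype.sum_bool, Finset.mul_sum,
    ← Finset.sum_add_distrib]
  exact Finset.sum_congr rfl fun κ _ => by ring

/-- The crossing is pushed through the columns one at a time from right to left. At the right end
both edges are empty, and there it has the weight `u - q * v` with `q = (s ^ 2)⁻¹`, which is the
prefactor. -/
theorem rowOp_exchange {s u v : ℂ} (hs : s ≠ 0) (hu : 1 - s * u ≠ 0) (hv : 1 - s * v ≠ 0) (L : ℕ)
    (l₁ l₂ : Bool) (τ σ : RowState L) :
    (u - (s ^ 2)⁻¹ * v) * (rowOp s L l₁ u * rowOp s L l₂ v) τ σ =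
      ∑ f₁, ∑ f₂, crossWeight (s ^ 2)⁻¹ u v l₁ l₂ f₁ f₂ *
        (rowOp s L f₂ v * rowOp s L f₁ u) τ σ := by
  induction L generalizing l₁ l₂ with
  | zero =>
    cases l₁ <;> cases l₂ <;>
      simp [Matrix.mul_apply, rowOp, rowWeight, crossWeight]
  | succ L ih =>
    obtain ⟨b, τ, rfl⟩ : ∃ b τ', τ = (Fin.cons b τ' : RowState (L + 1)) :=
      ⟨_, _, (Fin.cons_self_tail τ).symm⟩
    obtain ⟨a, σ, rfl⟩ : ∃ a σ', σ = (Fin.cons a σ' : RowState (L + 1)) :=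
      ⟨_, _, (Fin.cons_self_tail σ).symm⟩
    have ih' := fun e₁ e₂ => ih e₁ e₂ τ σ
    have yb := fun c₁ c₂ => yang_baxter hs hu hv l₁ l₂ a b c₁ c₂
    simp only [rowOp_mul_rowOp_cons]
    generalize (s ^ 2)⁻¹ = q at *
    generalize vertexWeight s u = wu at *
    generalize vertexWeight s v = wv at *
    generalize hP : (fun e₁ e₂ => (rowOp s L e₁ u * rowOp s L e₂ v) τ σ) = P at *
    generalize hQ : (fun e₂ e₁ => (rowOp s L e₂ v * rowOp s L e₁ u) τ σ) = Q at *
    simp only [funext_iff] at hP hQ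
    simp only [hP, hQ] at *
    calc _ = ∑ k, ∑ e₁, ∑ e₂, wv a l₂ k e₂ * wu k l₁ b e₁ * ((u - q * v) * P e₁ e₂) := by
          simp only [Finset.mul_sum, mul_left_comm]
      _ = ∑ c₁, ∑ c₂, (∑ k, ∑ e₁, ∑ e₂, wv a l₂ k e₂ * wu k l₁ b e₁ *
            crossWeight q u v e₁ e₂ c₁ c₂) * Q c₂ c₁ := by
          simp only [ih', Fintype.sum_bool]
          ring
      _ = _ := by
          simp only [yb]
          simp only [Fintype.sum_bool]
          ring

theorem continuousAt_rowOp {s u : ℂ} (hu : 1 - s * u ≠ 0) (L : ℕ) (l : Bool) (τ σ : RowState L) :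
    ContinuousAt (fun u => rowOp s L l u τ σ) u := by
  have hw : ∀ a b c d, ContinuousAt (fun u => vertexWeight s u a b c d) u := by
    intro a b c d
    cases a <;> cases b <;> cases c <;> cases d <;> simp only [vertexWeight] <;>
      first
      | exact continuousAt_const
      | exact ContinuousAt.div (by fun_prop) (by fun_prop) hu
  induction L generalizing l with
  | zero => exact continuousAt_const
  | succ L ih =>
    have : ContinuousAt (fun u => ∑ c, vertexWeight s u (σ 0) l (τ 0) c *
        rowOp s L c u (Fin.tail τ) (Fin.tail σ)) u :=
      tendsto_finsetSum _ fun c _ => (hw (σ 0) l (τ 0) c).mul (ih c (Fin.tail τ) (Fin.tail σ))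
    exact this

/-- With both inputs occupied the crossing has the same weight at both ends, so it cancels unless it
vanishes. -/
theorem rowOp_true_comm {s u v : ℂ} (hs : s ≠ 0) (hu : 1 - s * u ≠ 0) (hv : 1 - s * v ≠ 0)
    (L : ℕ) : rowOp s L true u * rowOp s L true v = rowOp s L true v * rowOp s L true u := by
  have key : ∀ u, 1 - s * u ≠ 0 → u - (s ^ 2)⁻¹ * v ≠ 0 →
      rowOp s L true u * rowOp s L true v = rowOp s L true v * rowOp s L true u := by
    intro u hu hne
    ext τ σ
    have := rowOp_exchange hs hu hv L true true τ σ
    simpa [crossWeight, hne] using this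
  -- At the zero of the crossing weight nothing can be cancelled, and the identity is obtained as a
  -- limit in `u`.
  by_cases hne : u - (s ^ 2)⁻¹ * v = 0
  · ext τ σ
    have h1 : ContinuousAt (fun u => (rowOp s L true u * rowOp s L true v) τ σ) u := by
      simp only [Matrix.mul_apply]
      exact tendsto_finsetSum _ fun κ _ => (continuousAt_rowOp hu _ _ _ _).mul continuousAt_const
    have h2 : ContinuousAt (fun u => (rowOp s L true v * rowOp s L true u) τ σ) u := by
      simp only [Matrix.mul_apply]
      exact tendsto_finsetSum _ fun κ _ => continuousAt_const.mul (continuousAt_rowOp hu _ _ _ _)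
    refine tendsto_nhds_unique_of_eventuallyEq (h1.tendsto.mono_left nhdsWithin_le_nhds)
      (h2.tendsto.mono_left (nhdsWithin_le_nhds (s := {u}ᶜ))) ?_
    have h3 : ∀ᶠ x in 𝓝[≠] u, 1 - s * x ≠ 0 :=
      nhdsWithin_le_nhds (ContinuousAt.eventually_ne (by fun_prop) hu)
    filter_upwards [h3, self_mem_nhdsWithin] with x hx hxu
    rw [key x hx]
    rw [← sub_eq_zero.mp hne]
    exact sub_ne_zero.mpr hxu
  · exact key u hu hne

/-- The coefficient of `B(y) A(x)` in `A(x) B(y)`. -/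
noncomputable def passCoeff (q x y : ℂ) : ℂ := (y - q * x) / (y - x)

/-- The coefficient of `B(x) A(y)` in `A(x) B(y)`. -/
noncomputable def swapCoeff (q x y : ℂ) : ℂ := (1 - q) * x / (x - y)

theorem rowOp_false_mul_rowOp_true {s x y : ℂ} (hs : s ≠ 0) (hx : 1 - s * x ≠ 0)
    (hy : 1 - s * y ≠ 0) (hxy : x ≠ y) (L : ℕ) :
    rowOp s L false x * rowOp s L true y =
      passCoeff (s ^ 2)⁻¹ x y • (rowOp s L true y * rowOp s L false x) +
        swapCoeff (s ^ 2)⁻¹ x y • (rowOp s L true x * rowOp s L false y) := by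
  ext τ σ
  have h := rowOp_exchange hs hy hx L true false τ σ
  have h1 := sub_ne_zero.mpr hxy
  have h2 := sub_ne_zero.mpr hxy.symm
  simp only [crossWeight, Fintype.sum_bool, zero_mul, zero_add, add_zero] at h
  simp only [Matrix.add_apply, Matrix.smul_apply, smul_eq_mul]
  unfold passCoeff swapCoeff
  generalize (s ^ 2)⁻¹ = q at *
  rw [← neg_sub y x, div_neg, eq_comm]
  field_simp
  linear_combination h

end YangBaxter

/-! ### The algebraic Bethe ansatz and the removal of column 0 -/

section Bethe

open Finset Matrix

/-- The sequence `z` with its term of index `i` removed. -/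
def skip {α : Type*} (i : ℕ) (z : ℕ → α) (j : ℕ) : α := if j < i then z j else z (j + 1)

theorem skip_of_lt {α : Type*} {i j : ℕ} (h : j < i) (z : ℕ → α) : skip i z j = z j := if_pos h

theorem skip_of_le {α : Type*} {i j : ℕ} (h : i ≤ j) (z : ℕ → α) : skip i z j = z (j + 1) :=
  if_neg (not_lt.mpr h)

/-- The partition function of `k` rows with an arrow entering each row, as a vector in the top
state. -/
noncomputable def freeLayer (s : ℂ) (L : ℕ) (z : ℕ → ℂ) : ℕ → RowState L → ℂ
  | 0 => Pi.single (fun _ => false) 1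
  | k + 1 => rowOp s L true (z k) *ᵥ freeLayer s L z k

theorem freeLayer_congr {s : ℂ} {L : ℕ} {z z' : ℕ → ℂ} {k : ℕ} (h : ∀ j < k, z j = z' j) :
    freeLayer s L z k = freeLayer s L z' k := by
  induction k with
  | zero => rfl
  | succ k ih => rw [freeLayer, freeLayer, h k (by omega), ih fun j hj => h j (by omega)]

theorem freeLayer_skip_succ {s : ℂ} {L : ℕ} {z : ℕ → ℂ} {k n : ℕ} (h : k < n) :
    freeLayer s L (skip k z) n = rowOp s L true (z n) *ᵥ freeLayer s L (skip k z) (n - 1) := by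
  obtain ⟨n, rfl⟩ : ∃ m, n = m + 1 := ⟨n - 1, by omega⟩
  rw [freeLayer, skip_of_le (by omega)]
  rfl

theorem rowOp_false_mulVec_vacuum (s u : ℂ) (L : ℕ) :
    rowOp s L false u *ᵥ Pi.single (fun _ => false) 1 = Pi.single (fun _ => false) 1 := by
  funext τ
  rw [mulVec_single_one]
  induction L with
  | zero =>
    have : τ = fun _ => false := funext fun x => x.elim0
    subst this
    simp [rowOp, rowWeight]
  | succ L ih =>
    obtain ⟨b, τ, rfl⟩ : ∃ b τ', τ = (Fin.cons b τ' : RowState (L + 1)) :=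
      ⟨_, _, (Fin.cons_self_tail τ).symm⟩
    have h0 : (fun _ => false : RowState (L + 1)) =
        (Fin.cons false (fun _ => false : RowState L) : RowState (L + 1)) := by
      funext x
      refine Fin.cases rfl (fun _ => rfl) x
    have ih := ih τ
    simp only [col_apply] at ih ⊢
    rw [h0, rowOp_cons, Fintype.sum_bool, ih]
    cases b
    · simp [vertexWeight, Pi.single_apply, Fin.cons_inj]
    · simp [vertexWeight, Pi.single_apply, Fin.cons_inj]

/-- The three-term relation that merges the two ways of producing the same unwanted term in the
Bethe ansatz. -/
theorem passCoeff_mul_swapCoeff_add {q x y t : ℂ} (hxy : x ≠ y) (hxt : x ≠ t) (hyt : y ≠ t) :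
    passCoeff q x y * swapCoeff q x t + swapCoeff q x y * swapCoeff q y t =
      swapCoeff q x t * passCoeff q t y := by
  have h1 := sub_ne_zero.mpr hxy
  have h2 := sub_ne_zero.mpr hxt
  have h3 := sub_ne_zero.mpr hyt
  have h4 := sub_ne_zero.mpr hxy.symm
  unfold passCoeff swapCoeff
  rw [← neg_sub x y, div_neg]
  field_simp
  ring

theorem erase_range_succ_of_lt {k n : ℕ} (h : k < n) :
    (range (n + 1)).erase k = insert n ((range n).erase k) := by
  rw [range_add_one, erase_insert_of_ne (by omega)]

theorem prod_erase_range_succ {M : Type*} [CommMonoid M] {k n : ℕ} (h : k < n) (F : ℕ → M) :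
    ∏ j ∈ (range (n + 1)).erase k, F j = F n * ∏ j ∈ (range n).erase k, F j := by
  rw [erase_range_succ_of_lt h, prod_insert (by simp)]

theorem erase_range_succ_self (n : ℕ) : (range (n + 1)).erase n = range n := by
  rw [range_add_one, erase_insert (by simp)]

/-- A(x) passes the topmost B, either keeping its parameter or exchanging it; induction applies to
A(x) and to A(z n) on the remaining rows. At the bottom A acts on the vacuum as the identity. -/
theorem rowOp_false_mulVec_freeLayer {s : ℂ} (hs : s ≠ 0) (L : ℕ) {z : ℕ → ℂ} {n : ℕ}
    (hz : ∀ j < n, 1 - s * z j ≠ 0) (hinj : Set.InjOn z (Set.Iio n)) {x : ℂ}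
    (hx : 1 - s * x ≠ 0) (hxz : ∀ j < n, x ≠ z j) :
    rowOp s L false x *ᵥ freeLayer s L z n =
      (∏ j ∈ range n, passCoeff (s ^ 2)⁻¹ x (z j)) • freeLayer s L z n +
        ∑ k ∈ range n, (swapCoeff (s ^ 2)⁻¹ x (z k) *
          ∏ j ∈ (range n).erase k, passCoeff (s ^ 2)⁻¹ (z k) (z j)) •
            (rowOp s L true x *ᵥ freeLayer s L (skip k z) (n - 1)) := by
  induction n generalizing x with
  | zero => simp only [freeLayer, rowOp_false_mulVec_vacuum, range_zero, prod_empty, sum_empty,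
      one_smul, add_zero]
  | succ n ih =>
    have hzn := hz n (by omega)
    have hz' : ∀ j < n, 1 - s * z j ≠ 0 := fun j hj => hz j (by omega)
    have hinj' : Set.InjOn z (Set.Iio n) := hinj.mono (Set.Iio_subset_Iio (by omega))
    have hne : ∀ j < n, z n ≠ z j := fun j hj h => by
      have := hinj (show n ∈ Set.Iio (n + 1) by simp) (show j ∈ Set.Iio (n + 1) by
        simp only [Set.mem_Iio]; omega) h
      omega
    have hxn := hxz n (by omega)
    rw [freeLayer, mulVec_mulVec, rowOp_false_mul_rowOp_true hs hx hzn hxn, add_mulVec, smul_mulVec,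
      smul_mulVec, ← mulVec_mulVec, ← mulVec_mulVec, ih hz' hinj' hx fun j hj => hxz j (by omega),
      ih hz' hinj' hzn hne]
    simp only [mulVec_add, mulVec_smul, mulVec_sum, mulVec_mulVec, smul_add, smul_smul, smul_sum]
    rw [prod_range_succ, sum_range_succ, erase_range_succ_self]
    have h1 : freeLayer s L (skip n z) (n + 1 - 1) = freeLayer s L z n :=
      freeLayer_congr fun j hj => skip_of_lt hj z
    have h2 : ∀ k ∈ range n, (swapCoeff (s ^ 2)⁻¹ x (z k) *
          ∏ j ∈ (range (n + 1)).erase k, passCoeff (s ^ 2)⁻¹ (z k) (z j)) •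
            (rowOp s L true x *ᵥ freeLayer s L (skip k z) (n + 1 - 1)) =
        (passCoeff (s ^ 2)⁻¹ x (z n) * (swapCoeff (s ^ 2)⁻¹ x (z k) *
          ∏ j ∈ (range n).erase k, passCoeff (s ^ 2)⁻¹ (z k) (z j))) •
            ((rowOp s L true (z n) * rowOp s L true x) *ᵥ freeLayer s L (skip k z) (n - 1)) +
        (swapCoeff (s ^ 2)⁻¹ x (z n) * (swapCoeff (s ^ 2)⁻¹ (z n) (z k) *
          ∏ j ∈ (range n).erase k, passCoeff (s ^ 2)⁻¹ (z k) (z j))) •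
            ((rowOp s L true x * rowOp s L true (z n)) *ᵥ freeLayer s L (skip k z) (n - 1)) := by
      intro k hk
      rw [mem_range] at hk
      -- The two contributions without row `k` differ only in the order of B(x) and B(z n), which
      -- commute.
      rw [rowOp_true_comm hs hzn hx, ← add_smul, Nat.add_sub_cancel, freeLayer_skip_succ hk,
        mulVec_mulVec, prod_erase_range_succ hk]
      congr 1
      have := passCoeff_mul_swapCoeff_add (q := (s ^ 2)⁻¹) hxn (hxz k (by omega)) (hne k hk)
      rw [← mul_assoc, ← this]
      ring
    rw [sum_congr rfl h2, sum_add_distrib, h1, mul_comm (∏ j ∈ range n, _)]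
    abel

/-- Column 0 cannot become empty again, so every arrow has crossed it horizontally. -/
theorem freeLayer_cons_false (s : ℂ) (L : ℕ) (z : ℕ → ℂ) (n : ℕ) (τ : RowState L) :
    freeLayer s (L + 1) z n (Fin.cons false τ : RowState (L + 1)) =
      (∏ j ∈ range n, (z j - s) / (1 - s * z j)) * freeLayer s L z n τ := by
  induction n generalizing τ with
  | zero =>
    have h0 : (fun _ => false : RowState (L + 1)) =
        (Fin.cons false (fun _ => false : RowState L) : RowState (L + 1)) := by
      funext x
      refine Fin.cases rfl (fun _ => rfl) x
    rw [freeLayer, freeLayer, h0]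
    simp [Pi.single_apply, Fin.cons_inj]
  | succ n ih =>
    rw [freeLayer, freeLayer, mulVec, mulVec, dotProduct, dotProduct, sum_rowState_succ, mul_sum]
    simp only [rowOp_cons, Fintype.sum_bool, vertexWeight, zero_mul, add_zero, sum_const_zero,
      zero_add, ih, prod_range_succ]
    exact sum_congr rfl fun σ _ => by ring

/-- Either column 0 was occupied below the last row, or the arrow of the last row turns up there and
the other columns receive no input. -/
theorem freeLayer_succ_cons_true (s : ℂ) (L : ℕ) (z : ℕ → ℂ) (n : ℕ) (τ : RowState L) :
    freeLayer s (L + 1) z (n + 1) (Fin.cons true τ : RowState (L + 1)) =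
      (z n - s⁻¹) / (1 - s * z n) *
        (rowOp s L true (z n) *ᵥ
          fun σ => freeLayer s (L + 1) z n (Fin.cons true σ : RowState (L + 1))) τ +
      (1 - (s ^ 2)⁻¹) / (1 - s * z n) * (∏ j ∈ range n, (z j - s) / (1 - s * z j)) *
        (rowOp s L false (z n) *ᵥ freeLayer s L z n) τ := by
  rw [freeLayer, mulVec, mulVec, mulVec, dotProduct, dotProduct, dotProduct, sum_rowState_succ,
    mul_sum, mul_sum]
  simp only [rowOp_cons, Fintype.sum_bool, vertexWeight, zero_mul, add_zero, zero_add,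
    freeLayer_cons_false]
  congr 1 <;> exact sum_congr rfl fun σ _ => by ring

/-- The coefficient of the partition function without the row `k` in the partition function of the
first `n` rows with an arrow in the column `0`. -/
noncomputable def removalCoeff (s : ℂ) (z : ℕ → ℂ) (n k : ℕ) : ℂ :=
  (1 - (s ^ 2)⁻¹) / (1 - s * z k) *
    ∏ j ∈ (range n).erase k, passCoeff (s ^ 2)⁻¹ (z k) (z j) * ((z j - s) / (1 - s * z j))

/-- The recursion matches the two cases for the last row: crossing an occupied column 0, or turning
there and then exchanging parameters with row `k`. Without the common products it is the partial
fraction identity `key`. -/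
theorem removalCoeff_succ {s : ℂ} (hs : s ≠ 0) {z : ℕ → ℂ} {n k : ℕ} (hk : k < n)
    (hzn : 1 - s * z n ≠ 0) (hzk : 1 - s * z k ≠ 0) (hne : z n ≠ z k) :
    removalCoeff s z (n + 1) k =
      (z n - s⁻¹) / (1 - s * z n) * removalCoeff s z n k +
      (1 - (s ^ 2)⁻¹) / (1 - s * z n) * (∏ j ∈ range n, (z j - s) / (1 - s * z j)) *
        (swapCoeff (s ^ 2)⁻¹ (z n) (z k) *
          ∏ j ∈ (range n).erase k, passCoeff (s ^ 2)⁻¹ (z k) (z j)) := by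
  rw [removalCoeff, removalCoeff, prod_erase_range_succ hk, prod_mul_distrib,
    ← mul_prod_erase (range n) _ (mem_range.mpr hk)]
  generalize ∏ j ∈ (range n).erase k, passCoeff (s ^ 2)⁻¹ (z k) (z j) = P
  generalize ∏ j ∈ (range n).erase k, (z j - s) / (1 - s * z j) = Q
  have key : passCoeff (s ^ 2)⁻¹ (z k) (z n) * ((z n - s) / (1 - s * z n)) / (1 - s * z k) =
      (z n - s⁻¹) / (1 - s * z n) / (1 - s * z k) +
        1 / (1 - s * z n) * ((z k - s) / (1 - s * z k)) * swapCoeff (s ^ 2)⁻¹ (z n) (z k) := by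
    have h1 := sub_ne_zero.mpr hne
    unfold passCoeff swapCoeff
    generalize z n = x at *
    generalize z k = y at *
    have h2 : 1 - x * s ≠ 0 := by rwa [mul_comm]
    have h3 : 1 - y * s ≠ 0 := by rwa [mul_comm]
    field_simp
    ring
  linear_combination (1 - (s ^ 2)⁻¹) * P * Q * key

theorem freeLayer_cons_true {s : ℂ} (hs : s ≠ 0) (L : ℕ) {z : ℕ → ℂ} {n : ℕ}
    (hz : ∀ j < n, 1 - s * z j ≠ 0) (hinj : Set.InjOn z (Set.Iio n)) (τ : RowState L) :
    freeLayer s (L + 1) z n (Fin.cons true τ : RowState (L + 1)) =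
      ∑ k ∈ range n, removalCoeff s z n k * freeLayer s L (skip k z) (n - 1) τ := by
  induction n generalizing τ with
  | zero => simp [freeLayer, Pi.single_apply, funext_iff, Fin.forall_fin_succ]
  | succ n ih =>
    have hzn := hz n (by omega)
    have hz' : ∀ j < n, 1 - s * z j ≠ 0 := fun j hj => hz j (by omega)
    have hinj' : Set.InjOn z (Set.Iio n) := hinj.mono (Set.Iio_subset_Iio (by omega))
    have hne : ∀ j < n, z n ≠ z j := fun j hj h => by
      have := hinj (show n ∈ Set.Iio (n + 1) by simp) (show j ∈ Set.Iio (n + 1) by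
        simp only [Set.mem_Iio]; omega) h
      omega
    have h1 : (fun σ => freeLayer s (L + 1) z n (Fin.cons true σ : RowState (L + 1))) =
        ∑ k ∈ range n, removalCoeff s z n k • freeLayer s L (skip k z) (n - 1) := by
      funext σ
      rw [ih hz' hinj', Finset.sum_apply]
      rfl
    rw [freeLayer_succ_cons_true, h1, rowOp_false_mulVec_freeLayer hs L hz' hinj' hzn hne,
      sum_range_succ, mulVec_sum, Nat.add_sub_cancel,
      freeLayer_congr (z := skip n z) (z' := z) fun j hj => skip_of_lt hj z]
    -- The missing row is the last one only in the diagonal term, where its arrow turns up and A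
    -- passes all B's with its own parameter.
    have h2 : removalCoeff s z (n + 1) n = (1 - (s ^ 2)⁻¹) / (1 - s * z n) *
        (∏ j ∈ range n, (z j - s) / (1 - s * z j)) *
          ∏ j ∈ range n, passCoeff (s ^ 2)⁻¹ (z n) (z j) := by
      rw [removalCoeff, erase_range_succ_self, prod_mul_distrib]
      ring
    rw [h2, Pi.add_apply, Pi.smul_apply, Finset.sum_apply, Finset.sum_apply, smul_eq_mul, mul_add, mul_sum,
      mul_sum, add_comm _ (∑ k ∈ range n, _), ← add_assoc, ← sum_add_distrib, ← mul_assoc]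
    congr 1
    refine sum_congr rfl fun k hk => ?_
    rw [mem_range] at hk
    rw [removalCoeff_succ hs hk hzn (hz' k hk) (hne k hk), freeLayer_skip_succ hk, mulVec_smul]
    simp only [Pi.smul_apply, smul_eq_mul]
    ring

end Bethe

/-! ### Partition functions restricted to the event -/

section Events

open Finset

theorem layer_eq_freeLayer {s : ℂ} {L : ℕ} {z : ℕ → ℂ} {E : ℕ → Set (RowState L)} {k : ℕ}
    (hE : ∀ j < k, E j = Set.univ) {τ : RowState L} (hτ : τ ∈ E k) :
    layer (fun j => vertexWeight s (z j)) E k τ = freeLayer s L z k τ := by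
  induction k generalizing τ with
  | zero => simp [layer, freeLayer, hτ, Pi.single_apply]
  | succ k ih =>
    rw [layer, if_pos hτ, freeLayer]
    refine sum_congr rfl fun σ _ => ?_
    rw [ih (fun j hj => hE j (by omega)) (hE k (by omega) ▸ Set.mem_univ σ)]
    rfl

theorem layer_eq_zero {R : Type*} [CommSemiring R] {w : ℕ → Bool → Bool → Bool → Bool → R} {L : ℕ}
    {E : ℕ → Set (RowState L)} {k : ℕ} {τ : RowState L} (hτ : τ ∉ E k) : layer w E k τ = 0 := by
  cases k <;> simp [layer, hτ]

theorem layer_succ_of_mem {R : Type*} [CommSemiring R] {w : ℕ → Bool → Bool → Bool → Bool → R}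
    {L : ℕ} {E : ℕ → Set (RowState L)} {k : ℕ} {τ : RowState L} (hτ : τ ∈ E (k + 1)) :
    layer w E (k + 1) τ = ∑ σ, rowWeight (w k) L true σ τ * layer w E k σ := if_pos hτ

theorem layer_cons_false_eq_zero {s : ℂ} {L : ℕ} {z : ℕ → ℂ} {E : ℕ → Set (RowState (L + 1))}
    {M k : ℕ} (hM : ∀ τ : RowState L, (Fin.cons false τ : RowState (L + 1)) ∉ E M) (hk : M ≤ k)
    (τ : RowState L) :
    layer (fun j => vertexWeight s (z j)) E k (Fin.cons false τ : RowState (L + 1)) = 0 := by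
  induction k, hk using Nat.le_induction generalizing τ with
  | base => exact layer_eq_zero (hM τ)
  | succ k hk ih =>
    rw [layer]
    split_ifs
    · rw [sum_rowState_succ]
      simp [ih, rowWeight_cons, vertexWeight]
    · rfl

/-- Up to height `M` nothing is restricted below the top, so `freeLayer_cons_true` applies. Above it
column 0 stays occupied, and each row only adds a crossing weight and acts by B on the other
columns. -/
theorem layer_cons_true {s : ℂ} (hs : s ≠ 0) {L : ℕ} {z : ℕ → ℂ} {E : ℕ → Set (RowState (L + 1))}
    {E' : ℕ → Set (RowState L)} {M k : ℕ} (hz : ∀ j < M, 1 - s * z j ≠ 0)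
    (hinj : Set.InjOn z (Set.Iio M)) (hM1 : 1 ≤ M) (hE : ∀ j < M, E j = Set.univ)
    (hM : ∀ τ : RowState L, (Fin.cons false τ : RowState (L + 1)) ∉ E M)
    (hE' : ∀ k τ, (Fin.cons true τ : RowState (L + 1)) ∈ E (k + 1) ↔ τ ∈ E' k)
    (hk : M ≤ k) (τ : RowState L) :
    layer (fun j => vertexWeight s (z j)) E k (Fin.cons true τ : RowState (L + 1)) =
      (∏ j ∈ Ico M k, (z j - s⁻¹) / (1 - s * z j)) * ∑ i ∈ range M, removalCoeff s z M i *
        layer (fun j => vertexWeight s (skip i z j)) E' (k - 1) τ := by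
  induction k, hk using Nat.le_induction generalizing τ with
  | base =>
    obtain ⟨M, rfl⟩ : ∃ m, M = m + 1 := ⟨M - 1, by omega⟩
    rw [Ico_self, prod_empty, one_mul, Nat.add_sub_cancel]
    by_cases hτ : τ ∈ E' M
    · have h1 : ∀ j < M, E' j = Set.univ := fun j hj => Set.eq_univ_of_forall fun σ => by
        rw [← hE', hE _ (by omega)]
        trivial
      rw [layer_eq_freeLayer hE ((hE' M τ).mpr hτ), freeLayer_cons_true hs L hz hinj]
      simp only [layer_eq_freeLayer h1 hτ, Nat.add_sub_cancel]
    · rw [layer_eq_zero (mt (hE' M τ).mp hτ)]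
      simp [layer_eq_zero hτ]
  | succ k hk ih =>
    obtain ⟨k, rfl⟩ : ∃ m, k = m + 1 := ⟨k - 1, by omega⟩
    by_cases hτ : τ ∈ E' (k + 1)
    · rw [layer_succ_of_mem ((hE' _ τ).mpr hτ), sum_rowState_succ, prod_Ico_succ_top hk]
      simp only [Fintype.sum_bool, layer_cons_false_eq_zero hM hk, mul_zero, sum_const_zero,
        add_zero, ih, rowWeight_cons, vertexWeight, zero_mul, Nat.add_sub_cancel,
        layer_succ_of_mem hτ, zero_add]
      simp only [mul_sum]
      rw [sum_comm]
      refine sum_congr rfl fun i hi => sum_congr rfl fun σ _ => ?_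
      rw [mem_range] at hi
      -- The row with index `k + 1` has index `k` once the lower row `i` is gone, so both sides use
      -- the same parameter.
      rw [skip_of_le (by omega : i ≤ k)]
      ring
    · rw [layer_eq_zero (mt (hE' _ τ).mp hτ)]
      simp [layer_eq_zero hτ]

/-- The states at height `k` allowed in the event `obsEvent N m`. -/
def levelEvent {K : ℕ} (m : Fin K → ℕ) (L k : ℕ) : Set (RowState L) :=
  {τ | ∀ i, m i = k → ∀ j ≤ (i : ℕ), ∃ h : j < L, τ ⟨j, h⟩ = true}

/-- The condition of index 0 concerns column 0 alone and becomes vacuous; each other one loses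
column 0, which lowers its index by one. -/
theorem cons_true_mem_levelEvent {K : ℕ} {m : Fin (K + 1) → ℕ} {m' : Fin K → ℕ}
    (hm : ∀ i, 1 ≤ m i) (hm' : ∀ i, m' i = m i.succ - 1) {L k : ℕ} {τ : RowState L} :
    (Fin.cons true τ : RowState (L + 1)) ∈ levelEvent m (L + 1) (k + 1) ↔
      τ ∈ levelEvent m' L k := by
  constructor
  · intro h i hi j hj
    obtain ⟨h1, h2⟩ := h i.succ (by have := hm i.succ; have := hm' i; omega) (j + 1)
      (by simpa using hj)
    exact ⟨by omega, h2⟩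
  · intro h i hi j hj
    obtain _ | j := j
    · exact ⟨by omega, rfl⟩
    · induction i using Fin.cases with
      | zero => simp at hj
      | succ i =>
        obtain ⟨h1, h2⟩ := h i (by have := hm' i; omega) j (by simpa using hj)
        exact ⟨by omega, h2⟩

end Events

/-! ### Signatures, occupied columns and fibers over the top signature -/

namespace PathConfig

variable {N : ℕ}

theorem mem_columns (ω : PathConfig N) (k : Fin (N + 1)) (x : ℕ) :
    x ∈ ω.columns k ↔ ω.vert x k = true := by simp [columns]

theorem strictAnti_sig (ω : PathConfig N) (k : Fin (N + 1)) : StrictAnti (ω.sig k).1 :=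
  fun _ _ h => ((ω.columns k).orderEmbOfFin (ω.card_columns k)).strictMono (Fin.rev_lt_rev.mpr h)

theorem mem_range_sig (ω : PathConfig N) (k : Fin (N + 1)) (x : ℕ) :
    (∃ i, (ω.sig k).1 i = x) ↔ ω.vert x k = true := by
  rw [← mem_columns]
  have := Finset.range_orderEmbOfFin (ω.columns k) (ω.card_columns k)
  rw [← Finset.mem_coe, ← this]
  constructor
  · rintro ⟨i, rfl⟩
    exact ⟨_, rfl⟩
  · rintro ⟨i, rfl⟩
    exact ⟨Fin.rev i, by simp [sig]⟩

/-- Parts are automatically distinct, since no two paths share a vertical edge; what remains is that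
the lowest columns are occupied. -/
theorem sig_mem_signStarR (ω : PathConfig N) (k : Fin (N + 1)) (r : ℕ) :
    ω.sig k ∈ signStarR k r ↔ ∀ j < r, ω.vert j k = true := by
  constructor
  · rintro ⟨-, h⟩ j hj
    obtain ⟨h1, h2⟩ := h j hj
    exact (ω.mem_range_sig k j).mp ⟨_, h2⟩
  · intro h
    refine ⟨ω.strictAnti_sig k, ?_⟩
    have hcard : r ≤ k := by
      rw [← ω.card_columns k, ← Finset.card_range r]
      exact Finset.card_le_card fun j hj => (ω.mem_columns k j).mpr (h j (Finset.mem_range.mp hj))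
    intro j
    induction j using Nat.strong_induction_on with
    | _ j ih =>
    intro hj
    refine ⟨by omega, ?_⟩
    have hmono := ((ω.columns k).orderEmbOfFin (ω.card_columns k)).strictMono
    have hval : ∀ i : Fin k, (ω.sig k).1 (Fin.rev i) =
        (ω.columns k).orderEmbOfFin (ω.card_columns k) i := fun i => by simp [sig]
    obtain ⟨i, hi⟩ := (ω.mem_range_sig k j).mpr (h j hj)
    obtain ⟨i, rfl⟩ := Fin.rev_surjective i
    rcases lt_trichotomy (i : ℕ) j with hlt | heq | hgt
    · obtain ⟨h1, h2⟩ := ih i hlt (by omega)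
      have h3 : (ω.sig k).1 (Fin.rev i) = i := h2
      omega
    · subst heq
      exact hi
    -- The parts in increasing order are strictly monotone, so the one at position `i > j` is at
    -- least `i` and cannot be `j`.
    · have h1 : ∀ d : ℕ, ∀ hd : d < k, d ≤ (ω.sig k).1 (Fin.rev ⟨d, hd⟩) := by
        intro d
        induction d with
        | zero => exact fun _ => Nat.zero_le _
        | succ d ihd =>
          intro hd
          have h2 := ihd (by omega)
          have h3 := ω.strictAnti_sig k (Fin.rev_lt_rev.mpr
            (show (⟨d, by omega⟩ : Fin k) < ⟨d + 1, hd⟩ from Nat.lt_succ_self d))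
          omega
      have := h1 i i.2
      rw [Fin.eta, hi] at this
      omega

theorem mem_obsEvent {K : ℕ} (m : Fin K → ℕ) (ω : PathConfig N) :
    ω ∈ obsEvent N m ↔ ∀ i, ∃ h : m i < N + 1, ∀ j ≤ (i : ℕ), ω.vert j ⟨m i, h⟩ = true := by
  simp only [obsEvent, Set.mem_ofPred_eq]
  refine forall_congr' fun i => exists_congr fun h => ?_
  rw [show (ω.sig ⟨m i, h⟩ ∈ signStarR (m i) (i + 1)) ↔ _ from ω.sig_mem_signStarR ⟨m i, h⟩ (i + 1)]
  exact forall_congr' fun j => by rw [Nat.lt_succ_iff]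

theorem eq_false_of_mem_within {L : ℕ} {ω : PathConfig N} (hω : ω ∈ within N L) {x : ℕ}
    (hx : L ≤ x) : (∀ k, ω.vert x k = false) ∧ ∀ j, ω.horiz x j = false := by
  induction N with
  | zero => exact ⟨fun k => by rw [show k = Fin.last 0 from Fin.ext (by omega)]; exact hω x hx,
      fun j => j.elim0⟩
  | succ N ih =>
    obtain ⟨h1, h2⟩ := ih (dropTop_mem_within hω)
    refine ⟨fun k => ?_, fun j => ?_⟩
    · induction k using Fin.lastCases with
      | last => exact hω x hx
      | cast k => exact h1 k
    · induction j using Fin.lastCases with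
      | last => exact horiz_last_eq_false hω hx
      | cast j => exact h2 j

theorem mem_obsEvent_iff_levelEvent {K : ℕ} {m : Fin K → ℕ} (hm : ∀ i, m i ≤ N) {L : ℕ}
    {ω : PathConfig N} (hω : ω ∈ within N L) :
    ω ∈ obsEvent N m ↔ ∀ k : Fin (N + 1), ω.state L k ∈ levelEvent m L k := by
  rw [mem_obsEvent]
  constructor
  · rintro h k i hi j hj
    obtain ⟨h1, h2⟩ := h i
    have h3 : ω.vert j k = true := by
      rw [← h2 j hj]
      congr 1
      exact Fin.ext hi.symm
    have h4 : j < L := by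
      by_contra h4
      rw [(eq_false_of_mem_within hω (not_lt.mp h4)).1] at h3
      simp at h3
    exact ⟨h4, h3⟩
  · intro h i
    refine ⟨Nat.lt_succ_of_le (hm i), fun j hj => ?_⟩
    exact (h ⟨m i, Nat.lt_succ_of_le (hm i)⟩ i rfl j hj).2

/-- The product of the vertex weights of a path collection. -/
noncomputable def configWeight {R : Type*} [CommSemiring R]
    (w : ℕ → Bool → Bool → Bool → Bool → R) (ω : PathConfig N) : R :=
  ∏ᶠ x : ℕ, ∏ j : Fin N,
    w j (ω.vert x j.castSucc) (ω.horiz x j) (ω.vert x j.succ) (ω.horiz (x + 1) j)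

theorem configWeight_eq_weightProd {R : Type*} [CommSemiring R]
    {w : ℕ → Bool → Bool → Bool → Bool → R} (hw : ∀ j, w j false false false false = 1) {L : ℕ}
    {ω : PathConfig N} (hω : ω ∈ within N L) : ω.configWeight w = ω.weightProd L w := by
  rw [configWeight, finprod_eq_prod_of_mulSupport_subset (s := Finset.range L), weightProd,
    Finset.prod_comm, Finset.prod_congr rfl]
  · intro j _
    exact (Fin.prod_univ_eq_prod_range (fun x => w j (ω.vert x j.castSucc) (ω.horiz x j)
      (ω.vert x j.succ) (ω.horiz (x + 1) j)) L).symm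
  · intro x hx
    by_contra hxL
    rw [Finset.coe_range, Set.mem_Iio, not_lt] at hxL
    refine hx (Finset.prod_eq_one fun j _ => ?_)
    obtain ⟨h1, h2⟩ := eq_false_of_mem_within hω hxL
    obtain ⟨-, h3⟩ := eq_false_of_mem_within hω (x := x + 1) (by omega)
    rw [h1, h1, h2, h3, hw]

end PathConfig

/-- The columns occupied by a signature. -/
def SignPos.state {N : ℕ} (l : SignPos N) (L : ℕ) : RowState L := fun x => decide (∃ i, l.1 i = x)

theorem SignPos.state_addOnes {N : ℕ} (l : SignPos N) (L : ℕ) :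
    l.addOnes.state (L + 1) = (Fin.cons true (l.state L) : RowState (L + 1)) := by
  funext x
  induction x using Fin.cases with
  | zero => simp [SignPos.state, SignPos.addOnes, Fin.exists_fin_succ', Fin.cons_zero]
  | succ x => simp [SignPos.state, SignPos.addOnes, Fin.exists_fin_succ', Fin.cons_succ]

theorem SignPos.strictAnti_addOnes {N : ℕ} (l : SignPos N) :
    StrictAnti l.addOnes.1 ↔ StrictAnti l.1 := by
  constructor
  · intro h i j hij
    have := h (Fin.castSucc_lt_castSucc_iff.mpr hij)
    simpa [SignPos.addOnes] using this
  · intro h i j hij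
    induction j using Fin.lastCases with
    | last =>
      induction i using Fin.lastCases with
      | last => exact absurd hij (lt_irrefl _)
      | cast i => simp [SignPos.addOnes]
    | cast j =>
      induction i using Fin.lastCases with
      | last => exact absurd hij (not_lt.mpr (Fin.castSucc_lt_last j).le)
      | cast i => simpa [SignPos.addOnes] using h (Fin.castSucc_lt_castSucc_iff.mp hij)

theorem SignPos.addOnes_injective {N : ℕ} :
    Function.Injective (SignPos.addOnes : SignPos N → SignPos (N + 1)) := by
  intro l l' h
  refine Subtype.ext (funext fun i => ?_)
  have := congrFun (congrArg Subtype.val h) i.castSucc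
  simpa [SignPos.addOnes] using this

/-- Only the last part can vanish when the parts are distinct, so all others can be lowered by one.
-/
theorem SignPos.exists_eq_addOnes {N : ℕ} {l : SignPos (N + 1)} (hl : StrictAnti l.1)
    (h0 : ∃ i, l.1 i = 0) : ∃ l', SignPos.addOnes l' = l := by
  obtain ⟨i, hi⟩ := h0
  have hlast : l.1 (Fin.last N) = 0 := by have := l.2 (Fin.le_last i); omega
  have hpos : ∀ i : Fin N, 1 ≤ l.1 i.castSucc := fun i => by
    have := hl (Fin.castSucc_lt_last i)
    omega
  refine ⟨⟨fun i => l.1 i.castSucc - 1, fun i j hij =>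
    Nat.sub_le_sub_right (l.2 (Fin.castSucc_le_castSucc_iff.mpr hij)) 1⟩, Subtype.ext ?_⟩
  funext j
  induction j using Fin.lastCases with
  | last => simp [SignPos.addOnes, hlast]
  | cast j => simpa [SignPos.addOnes] using Nat.sub_add_cancel (hpos j)

namespace PathConfig

variable {N : ℕ}

/-- The signature at the top of the strip. -/
noncomputable def topSig (ω : PathConfig N) : SignPos N := ω.sig (Fin.last N)

theorem topSig_eq_iff {L : ℕ} {l : SignPos N} (hl : ∀ i, l.1 i < L) (ω : PathConfig N) :
    ω.topSig = l ↔
      StrictAnti l.1 ∧ ω ∈ within N L ∧ ω.state L (Fin.last N) = l.state L := by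
  constructor
  · rintro rfl
    refine ⟨ω.strictAnti_sig _, fun x hx => ?_, funext fun x => ?_⟩
    · rw [← Bool.not_eq_true, ← mem_range_sig]
      rintro ⟨i, hi⟩
      have : (ω.sig (Fin.last N)).1 i < L := hl i
      omega
    · rw [Bool.eq_iff_iff]
      simp only [SignPos.state, decide_eq_true_eq]
      exact (ω.mem_range_sig (Fin.last N) x).symm
  · rintro ⟨h1, h2, h3⟩
    have key : Set.range (ω.sig (Fin.last N)).1 = Set.range l.1 := by
      ext x
      rw [Set.mem_range, mem_range_sig]
      by_cases hx : x < L
      · have := congrFun h3 ⟨x, hx⟩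
        rw [Bool.eq_iff_iff] at this
        simpa [SignPos.state, state] using this
      · rw [h2 x (by omega)]
        simp only [Bool.false_eq_true, Set.mem_range, false_iff, not_exists]
        intro i hi
        have := hl i
        omega
    exact Subtype.ext ((StrictAnti.range_inj (ω.strictAnti_sig (Fin.last N)) h1).mp key)

/-- The total weight of the path collections in `A` with top signature `l`. -/
noncomputable def fiberWeight {R : Type*} [CommSemiring R] [TopologicalSpace R]
    (w : ℕ → Bool → Bool → Bool → Bool → R) (A : Set (PathConfig N)) (l : SignPos N) : R :=
  ∑' ω : topSig ⁻¹' {l},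
    A.indicator (configWeight w) ω.1

theorem fiberWeight_of_not_strictAnti {R : Type*} [CommSemiring R] [TopologicalSpace R]
    {w : ℕ → Bool → Bool → Bool → Bool → R} {A : Set (PathConfig N)} {l : SignPos N}
    (hl : ¬ StrictAnti l.1) : fiberWeight w A l = 0 := by
  have : IsEmpty (topSig ⁻¹' {l}) :=
    ⟨fun ω => hl (by rw [← show ω.1.topSig = l from ω.2]
                     exact ω.1.strictAnti_sig _)⟩
  exact tsum_empty

/-- A collection with this top signature stays within the first `L` columns, so its fiber is finite
and the infinite sum is a transfer-matrix entry, for any large enough `L`. -/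
theorem fiberWeight_eq_layer {R : Type*} [CommSemiring R] [TopologicalSpace R] [T2Space R]
    {w : ℕ → Bool → Bool → Bool → Bool → R} (hw1 : ∀ j, w j false false false false = 1)
    (hw : ∀ j, Conservative (w j)) {A : Set (PathConfig N)} {L : ℕ} {E : ℕ → Set (RowState L)}
    (hA : ∀ ω ∈ within N L, ω ∈ A ↔ ∀ k : Fin (N + 1), ω.state L k ∈ E k)
    {l : SignPos N} (hl : ∀ i, l.1 i < L) (hanti : StrictAnti l.1) :
    fiberWeight w A l = layer w E N (l.state L) := by
  classical
  rw [fiberWeight, tsum_subtype _ (A.indicator (configWeight w)), ← sum_weightProd_eq_layer hw]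
  have hfib : ∀ ω : PathConfig N,
      ω ∈ topSig ⁻¹' {l} ↔
        ω ∈ within N L ∧ ω.state L (Fin.last N) = l.state L := fun ω => by
    have := topSig_eq_iff hl ω
    simp only [hanti, true_and] at this
    exact this
  rw [tsum_eq_sum (s := {ω ∈ (finite_within N L).toFinset |
    ω.state L (Fin.last N) = l.state L ∧ ∀ k : Fin (N + 1), ω.state L k ∈ E k})]
  · refine Finset.sum_congr rfl fun ω hω => ?_
    simp only [Finset.mem_filter, Set.Finite.mem_toFinset] at hω
    rw [Set.indicator_of_mem ((hfib ω).mpr ⟨hω.1, hω.2.1⟩),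
      Set.indicator_of_mem ((hA ω hω.1).mpr hω.2.2), configWeight_eq_weightProd hw1 hω.1]
  · intro ω hω
    simp only [Finset.mem_filter, Set.Finite.mem_toFinset] at hω
    by_contra hne
    have h1 := Set.mem_of_indicator_ne_zero hne
    rw [Set.indicator_of_mem h1] at hne
    have h2 := Set.mem_of_indicator_ne_zero hne
    rw [hfib] at h1
    exact hω ⟨h1.1, h1.2, (hA ω h1.1).mp h2⟩

end PathConfig

/-! ### Domination of partition functions with nonnegative weights -/

section Domination

open Finset

/-- The number of occupied columns. -/
def RowState.count {L : ℕ} (σ : RowState L) : ℕ := ∑ x, (σ x).toNat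

theorem RowState.count_succ {L : ℕ} (σ : RowState (L + 1)) :
    RowState.count σ = (σ 0).toNat + RowState.count (Fin.tail σ : RowState L) :=
  Fin.sum_univ_succ _

theorem count_add_of_rowWeight_ne_zero {R : Type*} [CommSemiring R]
    {w : Bool → Bool → Bool → Bool → R} (hw : Conservative w) {L : ℕ} {l : Bool}
    {σ τ : RowState L} (h : rowWeight w L l σ τ ≠ 0) :
    RowState.count σ + l.toNat = RowState.count τ := by
  induction L generalizing l with
  | zero => cases l <;> simp [rowWeight, RowState.count] at h ⊢
  | succ L ih =>
    obtain ⟨c, -, hc⟩ := exists_ne_zero_of_sum_ne_zero h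
    have h1 := ih (right_ne_zero_of_mul hc)
    have h2 : (σ 0).toNat + l.toNat = (τ 0).toNat + c.toNat :=
      not_imp_comm.mp (hw _ _ _ _) (left_ne_zero_of_mul hc)
    rw [RowState.count_succ, RowState.count_succ]
    omega

theorem count_of_layer_ne_zero {R : Type*} [CommSemiring R]
    {w : ℕ → Bool → Bool → Bool → Bool → R} (hw : ∀ j, Conservative (w j)) {L : ℕ}
    {E : ℕ → Set (RowState L)} {k : ℕ} {τ : RowState L} (h : layer w E k τ ≠ 0) :
    RowState.count τ = k := by
  classical
  induction k generalizing τ with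
  | zero =>
    rw [layer, ite_ne_right_iff] at h
    rw [h.1.2]
    simp [RowState.count]
  | succ k ih =>
    rw [layer, ite_ne_right_iff] at h
    obtain ⟨σ, -, hσ⟩ := exists_ne_zero_of_sum_ne_zero h.2
    have h1 := ih (right_ne_zero_of_mul hσ)
    have h2 := count_add_of_rowWeight_ne_zero (hw k) (left_ne_zero_of_mul hσ)
    simp only [Bool.toNat_true] at h2
    omega

theorem rowWeight_nonneg {w : Bool → Bool → Bool → Bool → ℝ} (hw : ∀ a b c d, 0 ≤ w a b c d)
    {L : ℕ} (l : Bool) (σ τ : RowState L) : 0 ≤ rowWeight w L l σ τ := by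
  induction L generalizing l with
  | zero => cases l <;> simp [rowWeight]
  | succ L ih => exact sum_nonneg fun c _ => mul_nonneg (hw _ _ _ _) (ih _ _ _)

theorem layer_nonneg {w : ℕ → Bool → Bool → Bool → Bool → ℝ}
    (hw : ∀ j a b c d, 0 ≤ w j a b c d) {L : ℕ} (E : ℕ → Set (RowState L)) (k : ℕ)
    (τ : RowState L) : 0 ≤ layer w E k τ := by
  classical
  induction k generalizing τ with
  | zero => rw [layer]; split_ifs <;> simp
  | succ k ih =>
    rw [layer]
    split_ifs
    · exact sum_nonneg fun σ _ => mul_nonneg (rowWeight_nonneg (hw k) _ _ _) (ih σ)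
    · exact le_rfl

/-- The constant is paid only at vertical edges. Their number is the number of arrows, so the loss
does not grow with `L`. -/
theorem rowWeight_le {w w' : Bool → Bool → Bool → Bool → ℝ} (hw : ∀ a b c d, 0 ≤ w a b c d)
    {K : ℝ} (h : ∀ a b c d, w a b c d ≤ K ^ (a.toNat + c.toNat) * w' a b c d)
    {L : ℕ} (l : Bool) (σ τ : RowState L) :
    rowWeight w L l σ τ ≤
      K ^ (RowState.count σ + RowState.count τ) * rowWeight w' L l σ τ := by
  induction L generalizing l with
  | zero => cases l <;> simp [rowWeight, RowState.count]
  | succ L ih =>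
    rw [rowWeight, rowWeight, mul_sum]
    refine sum_le_sum fun c _ => ?_
    refine (mul_le_mul (h _ _ _ _) (ih _ _ _) (rowWeight_nonneg hw _ _ _)
      ((hw _ _ _ _).trans (h _ _ _ _))).trans_eq ?_
    rw [RowState.count_succ, RowState.count_succ]
    ring

/-- Keeps only the configuration in which every arrow goes straight up. -/
theorem rowWeight_self_ge {w : Bool → Bool → Bool → Bool → ℝ} (hw : ∀ a b c d, 0 ≤ w a b c d)
    (hw1 : w false false false false = 1) {L : ℕ} (τ : RowState L) :
    w true false true false ^ RowState.count τ ≤ rowWeight w L false τ τ := by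
  induction L with
  | zero => simp [rowWeight, RowState.count]
  | succ L ih =>
    rw [rowWeight, Fintype.sum_bool, RowState.count_succ, pow_add]
    have h1 := mul_nonneg (hw (τ 0) false (τ 0) true)
      (rowWeight_nonneg hw true (Fin.tail τ : RowState L) (Fin.tail τ))
    refine le_trans ?_ (le_add_of_nonneg_left h1)
    refine (mul_le_mul_of_nonneg_left (ih (Fin.tail τ))
      (pow_nonneg (hw true false true false) _)).trans_eq ?_
    cases τ 0 <;> simp [hw1]

theorem rowWeight_mul_layer_le {w w' : ℕ → Bool → Bool → Bool → Bool → ℝ}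
    (hw : ∀ j a b c d, 0 ≤ w j a b c d) (hw' : ∀ j a b c d, 0 ≤ w' j a b c d)
    (hcons : ∀ j, Conservative (w j)) {j k : ℕ} {K : ℝ} (hK : 0 ≤ K)
    (h : ∀ a b c d, w k a b c d ≤ K ^ (a.toNat + c.toNat) * w' j a b c d) {L : ℕ}
    (E : ℕ → Set (RowState L)) (σ τ : RowState L) :
    rowWeight (w k) L true σ τ * layer w E k σ ≤
      K ^ (2 * k + 1) * rowWeight (w' j) L true σ τ * layer w E k σ := by
  by_cases h1 : layer w E k σ = 0
  · simp [h1]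
  · refine mul_le_mul_of_nonneg_right ?_ (layer_nonneg hw E k σ)
    by_cases h2 : rowWeight (w k) L true σ τ = 0
    · rw [h2]
      exact mul_nonneg (pow_nonneg hK _) (rowWeight_nonneg (hw' j) _ _ _)
    · have h3 := count_of_layer_ne_zero hcons h1
      have h4 := count_add_of_rowWeight_ne_zero (hcons k) h2
      have h5 := rowWeight_le (hw k) h true σ τ
      -- There are `k` arrows below the row and `k + 1` above it.
      rwa [← h4, h3, Bool.toNat_true, show k + (k + 1) = 2 * k + 1 by ring] at h5

theorem le_layer_succ_cons {w : ℕ → Bool → Bool → Bool → Bool → ℝ}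
    (hw : ∀ j a b c d, 0 ≤ w j a b c d) {L : ℕ} (a b c : Bool) (k : ℕ) (τ : RowState L) :
    w k a true b c * ∑ σ, rowWeight (w k) L c σ τ *
        layer w (fun _ => Set.univ) k (Fin.cons a σ : RowState (L + 1)) ≤
      layer w (fun _ => Set.univ) (k + 1) (Fin.cons b τ : RowState (L + 1)) := by
  rw [layer_succ_of_mem (Set.mem_univ _), sum_rowState_succ, mul_sum]
  refine le_trans ?_ (single_le_sum (f := fun a => ∑ σ : RowState L,
    rowWeight (w k) (L + 1) true (Fin.cons a σ : RowState (L + 1))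
      (Fin.cons b τ : RowState (L + 1)) * layer w (fun _ => Set.univ) k
        (Fin.cons a σ : RowState (L + 1))) (fun a _ => sum_nonneg fun σ _ =>
          mul_nonneg (rowWeight_nonneg (hw k) _ _ _) (layer_nonneg hw _ _ _)) (mem_univ a))
  refine sum_le_sum fun σ _ => ?_
  rw [← mul_assoc]
  refine mul_le_mul_of_nonneg_right ?_ (layer_nonneg hw _ _ _)
  rw [rowWeight_cons]
  exact single_le_sum (f := fun c => w k a true b c * rowWeight (w k) L c σ τ)
    (fun c _ => mul_nonneg (hw _ _ _ _ _) (rowWeight_nonneg (hw k) _ _ _)) (mem_univ c)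

/-- One more row preserves the domination of a partition function by another one with an additional
column, when the additional column has a positive weight in this row. -/
theorem layer_succ_le_of_layer_le {w w' : ℕ → Bool → Bool → Bool → Bool → ℝ}
    (hw : ∀ j a b c d, 0 ≤ w j a b c d) (hw' : ∀ j a b c d, 0 ≤ w' j a b c d)
    (hcons : ∀ j, Conservative (w j)) {j k : ℕ} {K C : ℝ} (hK : 0 ≤ K) (hC0 : 0 ≤ C)
    (h : ∀ a b c d, w k a b c d ≤ K ^ (a.toNat + c.toNat) * w' j a b c d) {a : Bool}
    (hpos : 0 < w' j a true a true)
    (hC : ∀ L, ∀ τ : RowState L, layer w (fun _ => Set.univ) k τ ≤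
      C * layer w' (fun _ => Set.univ) j (Fin.cons a τ : RowState (L + 1)))
    {L : ℕ} (τ : RowState L) :
    layer w (fun _ => Set.univ) (k + 1) τ ≤ K ^ (2 * k + 1) * C / w' j a true a true *
      layer w' (fun _ => Set.univ) (j + 1) (Fin.cons a τ : RowState (L + 1)) := by
  have hpow : 0 ≤ K ^ (2 * k + 1) := pow_nonneg hK _
  rw [layer_succ_of_mem (Set.mem_univ _)]
  calc _ ≤ ∑ σ, K ^ (2 * k + 1) * rowWeight (w' j) L true σ τ *
        (C * layer w' (fun _ => Set.univ) j (Fin.cons a σ : RowState (L + 1))) :=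
        sum_le_sum fun σ _ => (rowWeight_mul_layer_le hw hw' hcons hK h _ σ τ).trans
          (mul_le_mul_of_nonneg_left (hC L σ)
            (mul_nonneg hpow (rowWeight_nonneg (hw' j) _ _ _)))
    _ = K ^ (2 * k + 1) * C / w' j a true a true * (w' j a true a true *
        ∑ σ, rowWeight (w' j) L true σ τ *
          layer w' (fun _ => Set.univ) j (Fin.cons a σ : RowState (L + 1))) := by
        have := hpos.ne'
        field_simp
        rw [mul_sum]
        exact sum_congr rfl fun σ _ => by ring
    _ ≤ _ := mul_le_mul_of_nonneg_left (le_layer_succ_cons hw' a a true j τ)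
        (div_nonneg (mul_nonneg hpow hC0) hpos.le)

theorem exists_layer_le_cons_false {w w' : ℕ → Bool → Bool → Bool → Bool → ℝ}
    (hw : ∀ j a b c d, 0 ≤ w j a b c d) (hw' : ∀ j a b c d, 0 ≤ w' j a b c d)
    (hcons : ∀ j, Conservative (w j)) {k : ℕ}
    (h : ∀ j < k, ∃ K : ℝ, 0 ≤ K ∧
      ∀ a b c d, w j a b c d ≤ K ^ (a.toNat + c.toNat) * w' j a b c d)
    (hpos : ∀ j < k, 0 < w' j false true false true) :
    ∃ C : ℝ, 0 ≤ C ∧ ∀ L, ∀ τ : RowState L, layer w (fun _ => Set.univ) k τ ≤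
      C * layer w' (fun _ => Set.univ) k (Fin.cons false τ : RowState (L + 1)) := by
  induction k with
  | zero =>
    refine ⟨1, zero_le_one, fun L τ => ?_⟩
    simp [layer, funext_iff, Fin.forall_fin_succ]
  | succ k ih =>
    obtain ⟨C, hC0, hC⟩ := ih (fun j hj => h j (by omega)) fun j hj => hpos j (by omega)
    obtain ⟨K, hK0, hK⟩ := h k (by omega)
    have hp := hpos k (by omega)
    exact ⟨_, div_nonneg (mul_nonneg (pow_nonneg hK0 _) hC0) hp.le,
      fun L τ => layer_succ_le_of_layer_le hw hw' hcons hK0 hC0 hK hp hC τ⟩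

/-- In the enlarged system rows below `i` cross the new column 0 horizontally, the arrow of the
inserted row `i` turns up there while all others go straight up, and rows above `i` cross the
occupied column. Each of these has positive weight. -/
theorem exists_layer_le_cons_true {w w' : ℕ → Bool → Bool → Bool → Bool → ℝ}
    (hw : ∀ j a b c d, 0 ≤ w j a b c d) (hw' : ∀ j a b c d, 0 ≤ w' j a b c d)
    (hw1 : ∀ j, w' j false false false false = 1) (hcons : ∀ j, Conservative (w j)) {i n : ℕ}
    (h : ∀ j, ∃ K : ℝ, 0 ≤ K ∧
      ∀ a b c d, w j a b c d ≤ K ^ (a.toNat + c.toNat) * skip i w' j a b c d)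
    (hpass : ∀ j < i, 0 < w' j false true false true) (hturn : 0 < w' i false true true false)
    (hup : 0 < w' i true false true false) (hcross : ∀ j, i < j → 0 < w' j true true true true)
    (hin : i ≤ n) :
    ∃ C : ℝ, 0 ≤ C ∧ ∀ L, ∀ τ : RowState L, layer w (fun _ => Set.univ) n τ ≤
      C * layer w' (fun _ => Set.univ) (n + 1) (Fin.cons true τ : RowState (L + 1)) := by
  induction n, hin using Nat.le_induction with
  | base =>
    obtain ⟨C, hC0, hC⟩ := exists_layer_le_cons_false hw hw' hcons (k := i)
      (fun j hj => by simpa only [skip_of_lt hj] using h j) hpass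
    have hup' : 0 < w' i true false true false ^ i := pow_pos hup _
    refine ⟨C / (w' i false true true false * w' i true false true false ^ i),
      div_nonneg hC0 (mul_pos hturn hup').le, fun L τ => ?_⟩
    by_cases h0 : layer w (fun _ => Set.univ) i τ = 0
    · rw [h0]
      exact mul_nonneg (div_nonneg hC0 (mul_pos hturn hup').le) (layer_nonneg hw' _ _ _)
    have hcount := count_of_layer_ne_zero hcons h0
    have h1 := le_layer_succ_cons hw' false true false i τ
    have h2 := single_le_sum (f := fun σ => rowWeight (w' i) L false σ τ *
        layer w' (fun _ => Set.univ) i (Fin.cons false σ : RowState (L + 1)))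
      (fun σ _ => mul_nonneg (rowWeight_nonneg (hw' i) _ _ _) (layer_nonneg hw' _ _ _))
      (mem_univ τ)
    have h3 := rowWeight_self_ge (hw' i) (hw1 i) τ
    rw [hcount] at h3
    calc _ ≤ C * layer w' (fun _ => Set.univ) i (Fin.cons false τ : RowState (L + 1)) := hC L τ
      _ = C / (w' i false true true false * w' i true false true false ^ i) *
          (w' i false true true false * (w' i true false true false ^ i *
            layer w' (fun _ => Set.univ) i (Fin.cons false τ : RowState (L + 1)))) := by
          have := hturn.ne'
          have := hup'.ne'
          field_simp
      _ ≤ _ := mul_le_mul_of_nonneg_left (le_trans (mul_le_mul_of_nonneg_left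
          (le_trans (mul_le_mul_of_nonneg_right h3 (layer_nonneg hw' _ _ _)) h2) hturn.le) h1)
          (div_nonneg hC0 (mul_pos hturn hup').le)
  | succ n hin ih =>
    obtain ⟨C, hC0, hC⟩ := ih
    obtain ⟨K, hK0, hK⟩ := h n
    rw [skip_of_le hin] at hK
    have hp := hcross (n + 1) (by omega)
    exact ⟨_, div_nonneg (mul_nonneg (pow_nonneg hK0 _) hC0) hp.le,
      fun L τ => layer_succ_le_of_layer_le hw hw' hcons hK0 hC0 hK hp hC τ⟩

/-- Vertices without vertical arrows occur arbitrarily often, so they must compare with constant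
one; elsewhere the largest of the finitely many ratios serves. -/
theorem exists_pow_bound {w w' : Bool → Bool → Bool → Bool → ℝ}
    (hw' : ∀ a b c d, 0 ≤ w' a b c d) (h0 : ∀ a b c d, w' a b c d = 0 → w a b c d = 0)
    (h1 : ∀ b d, w false b false d ≤ w' false b false d) :
    ∃ K : ℝ, 0 ≤ K ∧ ∀ a b c d, w a b c d ≤ K ^ (a.toNat + c.toNat) * w' a b c d := by
  obtain ⟨K, hK⟩ := Finite.exists_le fun p : Bool × Bool × Bool × Bool =>
    w p.1 p.2.1 p.2.2.1 p.2.2.2 / w' p.1 p.2.1 p.2.2.1 p.2.2.2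
  refine ⟨max K 1, zero_le_one.trans (le_max_right _ _), fun a b c d => ?_⟩
  by_cases hac : a.toNat + c.toNat = 0
  · have ha : a = false := by cases a <;> simp at hac ⊢
    have hc : c = false := by cases c <;> simp at hac ⊢
    subst ha hc
    simpa using h1 b d
  · by_cases hz : w' a b c d = 0
    · rw [h0 a b c d hz, hz, mul_zero]
    · calc w a b c d = w a b c d / w' a b c d * w' a b c d := (div_mul_cancel₀ _ hz).symm
        _ ≤ max K 1 * w' a b c d :=
          mul_le_mul_of_nonneg_right ((hK (a, b, c, d)).trans (le_max_left _ _)) (hw' _ _ _ _)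
        _ ≤ _ := mul_le_mul_of_nonneg_right (le_self_pow₀ (le_max_right _ _) hac) (hw' _ _ _ _)

/-- If the entering arrow can never turn up, it reaches the right end, where no output is allowed.
-/
theorem rowWeight_true_eq_zero {R : Type*} [CommSemiring R] {w : Bool → Bool → Bool → Bool → R}
    (hw : Conservative w) (h0 : w false true true false = 0) {L : ℕ} (σ τ : RowState L) :
    rowWeight w L true σ τ = 0 := by
  induction L with
  | zero => simp [rowWeight]
  | succ L ih =>
    rw [rowWeight, Fintype.sum_bool, ih, mul_zero, zero_add]
    cases σ 0 <;> cases τ 0 <;> simp [h0, hw _ _ _ _]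

/-- The absolute values of the six-vertex weights. -/
noncomputable def absWeight (s u : ℂ) (a b c d : Bool) : ℝ := ‖vertexWeight s u a b c d‖

theorem absWeight_nonneg (s u : ℂ) (a b c d : Bool) : 0 ≤ absWeight s u a b c d := norm_nonneg _

theorem absWeight_conservative (s u : ℂ) : Conservative (absWeight s u) := fun a b c d h => by
  rw [absWeight, vertexWeight_conservative s u a b c d h, norm_zero]

/-- At the parameter `s` the weight of a horizontal passage is zero, so moving to `v` only increases
it. The condition `v ≠ 0` keeps the turn to the right from vanishing. -/
theorem exists_absWeight_le {s v : ℂ} (hs : s ≠ 0) (hs2 : s ^ 2 ≠ 1) (hv : 1 - s * v ≠ 0)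
    (hvs : v ≠ s) (hv0 : v ≠ 0) :
    ∃ K : ℝ, 0 ≤ K ∧ ∀ a b c d,
      absWeight s s a b c d ≤ K ^ (a.toNat + c.toNat) * absWeight s v a b c d := by
  have h1 : 1 - s⁻¹ * v ≠ 0 := fun h => hvs (by field_simp at h; linear_combination -h)
  have h2 : 1 - s ^ 2 ≠ 0 := sub_ne_zero.mpr hs2.symm
  have h3 : 1 - (s ^ 2)⁻¹ ≠ 0 := fun h => hs2 (by field_simp at h; linear_combination h)
  have h4 : v - s ≠ 0 := sub_ne_zero.mpr hvs
  have h5 : v - s⁻¹ ≠ 0 := fun h => hv (by field_simp at h; linear_combination -h)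
  refine exists_pow_bound (absWeight_nonneg s v) ?_ ?_
  · intro a b c d
    cases a <;> cases b <;> cases c <;> cases d <;>
      simp [absWeight, vertexWeight, h1, h2, h3, h4, h5, hv, hv0]
  · intro b d
    cases b <;> cases d <;> simp [absWeight, vertexWeight]
    positivity

end Domination

/-! ### Infinite sums grouped by the top signature -/

namespace PathConfig

variable {N : ℕ}

theorem exists_mem_within (ω : PathConfig N) : ∃ L, ω ∈ within N L :=
  ω.bounded.imp fun _ hX _ hx => ω.vert_eq_false hX hx _

theorem norm_configWeight (s : ℂ) (z : ℕ → ℂ) (ω : PathConfig N) :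
    ‖ω.configWeight fun j => vertexWeight s (z j)‖ = ω.configWeight fun j => absWeight s (z j) := by
  obtain ⟨L, hL⟩ := ω.exists_mem_within
  rw [configWeight_eq_weightProd (fun _ => rfl) hL,
    configWeight_eq_weightProd (fun _ => by simp [absWeight, vertexWeight]) hL]
  simp [weightProd, norm_prod, absWeight]

theorem norm_pathWeight (s : ℂ) (f : SignPos N → ℝ) (z : ℕ → ℂ) (ω : PathConfig N) :
    ‖pathWeight s f (fun j : Fin N => z j) ω‖ =
      ω.configWeight (fun j => absWeight s (z j)) * |f ω.topSig| := by
  rw [← norm_configWeight, ← Real.norm_eq_abs, ← Complex.norm_real, ← norm_mul]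
  rfl

theorem finite_fiber (l : SignPos N) :
    Finite (topSig ⁻¹' {l}) := by
  obtain ⟨L, hL⟩ := Finite.exists_le l.1
  refine ((finite_within N (L + 1)).subset fun ω hω => ?_).to_subtype
  exact ((topSig_eq_iff (fun i => Nat.lt_succ_of_le (hL i)) ω).mp hω).2.1

theorem summable_norm_pathWeight_iff (s : ℂ) (f : SignPos N → ℝ) (z : ℕ → ℂ) :
    (Summable fun ω : PathConfig N => ‖pathWeight s f (fun j : Fin N => z j) ω‖) ↔
      Summable fun l => |f l| * fiberWeight (fun j => absWeight s (z j)) Set.univ l := by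
  rw [summable_partition (fun ω => norm_nonneg _)
    (s := fun l => topSig ⁻¹' {l})
    fun ω => ⟨ω.topSig, rfl, fun l hl => hl.symm⟩]
  have h1 : ∀ l, (∑' ω : topSig ⁻¹' {l},
      ‖pathWeight s f (fun j : Fin N => z j) ω.1‖) =
        |f l| * fiberWeight (fun j => absWeight s (z j)) Set.univ l := by
    intro l
    rw [fiberWeight, ← tsum_mul_left]
    refine tsum_congr fun ω => ?_
    rw [norm_pathWeight, show ω.1.topSig = l from ω.2, mul_comm, Set.indicator_univ]
  refine Iff.trans ?_ (summable_congr h1)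
  refine and_iff_right fun l => ?_
  have := finite_fiber l
  exact Summable.of_finite

theorem hasSum_fiberWeight {s : ℂ} {f : SignPos N → ℝ} {z : ℕ → ℂ}
    (h : Summable fun ω : PathConfig N => ‖pathWeight s f (fun j : Fin N => z j) ω‖) {K : ℕ}
    (m : Fin K → ℕ) :
    HasSum (fun l => (f l : ℂ) * fiberWeight (fun j => vertexWeight s (z j)) (obsEvent N m) l)
      (obsWeight s f m fun j : Fin N => z j) := by
  have h1 : Summable ((obsEvent N m).indicator (pathWeight s f fun j : Fin N => z j)) :=
    (Summable.of_norm h).indicator _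
  have h2 := h1.hasSum.tsum_fiberwise topSig
  rw [← tsum_subtype] at h2
  refine h2.congr_fun fun l => ?_
  rw [fiberWeight, ← tsum_mul_left]
  refine tsum_congr fun ω => ?_
  by_cases hω : ω.1 ∈ obsEvent N m
  · have h3 : ω.1.topSig = l := ω.2
    rw [Set.indicator_of_mem hω, Set.indicator_of_mem hω, mul_comm, ← congrArg f h3]
    rfl
  · rw [Set.indicator_of_notMem hω, Set.indicator_of_notMem hω, mul_zero]

end PathConfig

/-! ### Summability after the removal of a row -/

theorem fiberWeight_eq_zero_of_sq_eq_one {s : ℂ} (hs : s ^ 2 = 1) {N : ℕ} (z : ℕ → ℂ)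
    (l : SignPos (N + 1)) :
    PathConfig.fiberWeight (fun j => absWeight s (z j)) Set.univ l = 0 := by
  by_cases hl : StrictAnti l.1
  · obtain ⟨L, hL⟩ := Finite.exists_le l.1
    rw [PathConfig.fiberWeight_eq_layer (fun _ => by simp [absWeight, vertexWeight])
      (fun j => absWeight_conservative _ _) (E := fun _ => Set.univ) (by simp)
      (fun i => Nat.lt_succ_of_le (hL i)) hl, layer_succ_of_mem (Set.mem_univ _)]
    refine Finset.sum_eq_zero fun σ _ => ?_
    rw [rowWeight_true_eq_zero (absWeight_conservative _ _), zero_mul]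
    simp [absWeight, vertexWeight, hs]
  · exact PathConfig.fiberWeight_of_not_strictAnti hl

theorem removeNth_eq_skip {n : ℕ} (i : Fin (n + 1)) (z : ℕ → ℂ) :
    i.removeNth (fun j : Fin (n + 1) => z j) = fun j : Fin n => skip i z j := by
  funext j
  simp only [Fin.removeNth, Fin.succAbove, skip, Fin.lt_def, Fin.val_castSucc]
  split_ifs <;> simp

/-- A point of an open set can be moved so that none of its coordinates equals `s`. -/
theorem exists_mem_ne {s : ℂ} (hs : s ≠ 0) {N : ℕ} {U : Set (Fin N → ℂ)} (hU : IsOpen U)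
    {z : ℕ → ℂ} (hz : (fun j : Fin N => z j) ∈ U) (hden : ∀ j, 1 - s * z j ≠ 0) :
    ∃ z' : ℕ → ℂ, (fun j : Fin N => z' j) ∈ U ∧ ∀ j, 1 - s * z' j ≠ 0 ∧ z' j ≠ s ∧
      (z j ≠ s → z' j = z j) ∧ (z j = s → z' j ≠ 0) := by
  classical
  by_cases hex : ∃ j, z j = s
  · obtain ⟨j₀, hj₀⟩ := hex
    have hss : 1 - s * s ≠ 0 := by
      have := hden j₀
      rwa [hj₀] at this
    let F : ℂ → Fin N → ℂ := fun v j => if z j = s then v else z j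
    have hF : Continuous F := continuous_pi fun j => by
      by_cases h : z j = s
      · simpa [F, h] using continuous_id'
      · simpa [F, h] using continuous_const
    have hFs : F s = fun j : Fin N => z j := by
      funext j
      by_cases h : z j = s <;> simp [F, h]
    have h1 : ∀ᶠ v in 𝓝[≠] s, F v ∈ U := nhdsWithin_le_nhds
      (hF.continuousAt.eventually_mem (by rw [hFs]; exact hU.mem_nhds hz))
    have h2 : ∀ᶠ v in 𝓝[≠] s, 1 - s * v ≠ 0 :=
      nhdsWithin_le_nhds (ContinuousAt.eventually_ne (by fun_prop) hss)
    have h3 : ∀ᶠ v in 𝓝[≠] s, v ≠ 0 := nhdsWithin_le_nhds (eventually_ne_nhds hs)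
    obtain ⟨v, hv1, hv2, hv3, hv4⟩ := (h1.and (h2.and (h3.and self_mem_nhdsWithin))).exists
    refine ⟨fun j => if z j = s then v else z j, hv1, fun j => ?_⟩
    by_cases h : z j = s
    · simpa [h, hv2, hv3] using hv4
    · simpa [h] using hden j
  · push Not at hex
    exact ⟨z, hz, fun j => ⟨hden j, hex j, fun _ => rfl, fun h => absurd h (hex j)⟩⟩

theorem exists_fiberWeight_le {s : ℂ} (hs : s ≠ 0) (hs2 : s ^ 2 ≠ 1) {z z' : ℕ → ℂ}
    (hz' : ∀ j, 1 - s * z' j ≠ 0 ∧ z' j ≠ s ∧ (z j ≠ s → z' j = z j) ∧ (z j = s → z' j ≠ 0))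
    {i n : ℕ} (hi : i ≤ n) :
    ∃ C : ℝ, 0 ≤ C ∧ ∀ l : SignPos n,
      PathConfig.fiberWeight (fun j => absWeight s (skip i z j)) Set.univ l ≤
        C * PathConfig.fiberWeight (fun j => absWeight s (z' j)) Set.univ l.addOnes := by
  have h2 : 1 - (s ^ 2)⁻¹ ≠ 0 := fun h => hs2 (by field_simp at h; linear_combination h)
  have hpos : ∀ j, 0 < absWeight s (z' j) false true false true ∧
      0 < absWeight s (z' j) false true true false ∧
      0 < absWeight s (z' j) true false true false ∧
      0 < absWeight s (z' j) true true true true := by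
    intro j
    obtain ⟨h3, h4, -, -⟩ := hz' j
    have h5 : 1 - s⁻¹ * z' j ≠ 0 := fun h => h4 (by field_simp at h; linear_combination -h)
    have h6 : z' j - s⁻¹ ≠ 0 := fun h => h3 (by field_simp at h; linear_combination -h)
    exact ⟨norm_pos_iff.mpr (div_ne_zero (sub_ne_zero.mpr h4) h3),
      norm_pos_iff.mpr (div_ne_zero h2 h3), norm_pos_iff.mpr (div_ne_zero h5 h3),
      norm_pos_iff.mpr (div_ne_zero h6 h3)⟩
  have hrow : ∀ j, ∃ K : ℝ, 0 ≤ K ∧ ∀ a b c d, absWeight s (skip i z j) a b c d ≤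
      K ^ (a.toNat + c.toNat) * skip i (fun j => absWeight s (z' j)) j a b c d := by
    have key : ∀ j, ∃ K : ℝ, 0 ≤ K ∧ ∀ a b c d, absWeight s (z j) a b c d ≤
        K ^ (a.toNat + c.toNat) * absWeight s (z' j) a b c d := by
      intro j
      obtain ⟨h3, h4, h5, h6⟩ := hz' j
      by_cases h : z j = s
      · rw [h]
        exact exists_absWeight_le hs hs2 h3 h4 (h6 h)
      · rw [h5 h]
        exact ⟨1, zero_le_one, fun a b c d => by simp⟩
    intro j
    rcases lt_or_ge j i with hj | hj
    · simpa only [skip_of_lt hj] using key j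
    · simpa only [skip_of_le hj] using key (j + 1)
  have hw1 : ∀ u, absWeight s u false false false false = 1 := fun u => by
    simp [absWeight, vertexWeight]
  obtain ⟨C, hC0, hC⟩ := exists_layer_le_cons_true (fun j => absWeight_nonneg s (skip i z j))
    (fun j => absWeight_nonneg s (z' j)) (fun j => hw1 _) (fun j => absWeight_conservative _ _) hrow
    (fun j _ => (hpos j).1) (hpos i).2.1 (hpos i).2.2.1 (fun j _ => (hpos j).2.2.2) hi
  refine ⟨C, hC0, fun l => ?_⟩
  by_cases hl : StrictAnti l.1
  · obtain ⟨L, hL⟩ := Finite.exists_le l.1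
    have hL2 : ∀ i, l.addOnes.1 i < L + 1 + 1 := fun i => by
      induction i using Fin.lastCases with
      | last => simp [SignPos.addOnes]
      | cast i => simpa [SignPos.addOnes] using Nat.lt_succ_of_le (hL i)
    rw [PathConfig.fiberWeight_eq_layer (fun _ => hw1 _) (fun j => absWeight_conservative _ _)
        (E := fun _ => Set.univ) (by simp) (fun i => Nat.lt_succ_of_le (hL i)) hl,
      PathConfig.fiberWeight_eq_layer (fun _ => hw1 _) (fun j => absWeight_conservative _ _)
        (E := fun _ => Set.univ) (by simp) hL2 (l.strictAnti_addOnes.mpr hl),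
      SignPos.state_addOnes]
    exact hC _ _
  · rw [PathConfig.fiberWeight_of_not_strictAnti hl,
      PathConfig.fiberWeight_of_not_strictAnti (mt l.strictAnti_addOnes.mp hl), mul_zero]

/-- Absolute summability at the displaced point, restricted to the signatures `l.addOnes`, dominates
the smaller system at the original point. -/
theorem summable_norm_pathWeight_skip {s : ℂ} (hs : s ≠ 0) {n : ℕ} {f : SignPos (n + 1) → ℝ}
    {U : Set (Fin (n + 1) → ℂ)} (hU : IsOpen U)
    (hsum : ∀ z ∈ U, Summable fun ω : PathConfig (n + 1) => ‖pathWeight s f z ω‖)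
    {z : ℕ → ℂ} (hz : (fun j : Fin (n + 1) => z j) ∈ U) (hden : ∀ j, 1 - s * z j ≠ 0)
    {g : SignPos n → ℝ} (hg : ∀ l, g l = f l.addOnes) {i : ℕ} (hi : i ≤ n) :
    Summable fun ω : PathConfig n => ‖pathWeight s g (fun j : Fin n => skip i z j) ω‖ := by
  by_cases hs2 : s ^ 2 = 1
  · obtain _ | n := n
    · exact Summable.of_finite
    · rw [PathConfig.summable_norm_pathWeight_iff]
      simpa only [fiberWeight_eq_zero_of_sq_eq_one hs2, mul_zero] using summable_zero
  · obtain ⟨z', hz'U, hz'⟩ := exists_mem_ne hs hU hz hden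
    have h1 := (PathConfig.summable_norm_pathWeight_iff s f z').mp (hsum _ hz'U)
    have h2 := h1.comp_injective SignPos.addOnes_injective
    obtain ⟨C, hC0, hC⟩ := exists_fiberWeight_le hs hs2 hz' hi
    rw [PathConfig.summable_norm_pathWeight_iff]
    refine Summable.of_nonneg_of_le (fun l => mul_nonneg (abs_nonneg _) ?_) (fun l => ?_)
      (h2.mul_left C)
    · refine tsum_nonneg fun ω => ?_
      rw [Set.indicator_univ, ← PathConfig.norm_configWeight]
      exact norm_nonneg _
    · rw [hg, Function.comp_apply, mul_left_comm]
      exact mul_le_mul_of_nonneg_left (hC l) (abs_nonneg _)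

/-! ### The recursion for each top signature and its summation -/

/-- On the event column 0 is occupied from height `m 0` up to the top, so the top signature has a
part 0. -/
theorem fiberWeight_obsEvent_eq_zero {s : ℂ} {n k : ℕ} {m : Fin (k + 1) → ℕ}
    (hmN : ∀ i, m i ≤ n + 1) {z : ℕ → ℂ} {l : SignPos (n + 1)} (hl : ¬ ∃ l', SignPos.addOnes l' = l) :
    PathConfig.fiberWeight (fun j => vertexWeight s (z j)) (obsEvent (n + 1) m) l = 0 := by
  by_cases hanti : StrictAnti l.1
  · obtain ⟨L, hL⟩ := Finite.exists_le l.1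
    rw [PathConfig.fiberWeight_eq_layer (fun _ => rfl) (fun j => vertexWeight_conservative _ _)
      (fun ω hω => PathConfig.mem_obsEvent_iff_levelEvent hmN hω)
      (fun i => Nat.lt_succ_of_le (hL i)) hanti, ← Fin.cons_self_tail (l.state (L + 1))]
    have h0 : l.state (L + 1) 0 = false := by
      rw [← Bool.not_eq_true, SignPos.state, decide_eq_true_eq]
      exact fun h => hl (SignPos.exists_eq_addOnes hanti h)
    rw [h0]
    refine layer_cons_false_eq_zero (M := m 0) (fun τ hτ => ?_) (hmN 0) _
    obtain ⟨h1, h2⟩ := hτ 0 rfl 0 (Nat.zero_le _)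
    exact Bool.false_ne_true h2
  · exact PathConfig.fiberWeight_of_not_strictAnti hanti

theorem fiberWeight_obsEvent_addOnes {s : ℂ} (hs : s ≠ 0) {n k : ℕ} {m : Fin (k + 1) → ℕ}
    (hm : ∀ i, m 0 ≤ m i) (hm1 : 1 ≤ m 0) (hmN : ∀ i, m i ≤ n + 1) {z : ℕ → ℂ}
    (hz : ∀ j < m 0, 1 - s * z j ≠ 0) (hinj : Set.InjOn z (Set.Iio (m 0)))
    {m' : Fin k → ℕ} (hm' : ∀ i, m' i = m i.succ - 1) (l : SignPos n) :
    PathConfig.fiberWeight (fun j => vertexWeight s (z j)) (obsEvent (n + 1) m) l.addOnes =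
      (∏ j ∈ Finset.Ico (m 0) (n + 1), (z j - s⁻¹) / (1 - s * z j)) *
        ∑ i ∈ Finset.range (m 0), removalCoeff s z (m 0) i *
          PathConfig.fiberWeight (fun j => vertexWeight s (skip i z j)) (obsEvent n m') l := by
  by_cases hl : StrictAnti l.1
  · obtain ⟨L, hL⟩ := Finite.exists_le l.1
    have hL2 : ∀ i, l.addOnes.1 i < L + 1 + 1 := fun i => by
      induction i using Fin.lastCases with
      | last => simp [SignPos.addOnes]
      | cast i => simpa [SignPos.addOnes] using Nat.lt_succ_of_le (hL i)
    have hm'N : ∀ i, m' i ≤ n := fun i => by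
      have := hmN i.succ
      have := hm' i
      omega
    rw [PathConfig.fiberWeight_eq_layer (fun _ => rfl) (fun j => vertexWeight_conservative _ _)
      (fun ω hω => PathConfig.mem_obsEvent_iff_levelEvent hmN hω) hL2
      (l.strictAnti_addOnes.mpr hl), SignPos.state_addOnes,
      layer_cons_true hs hz hinj hm1 (E' := levelEvent m' (L + 1)) ?_ ?_ ?_ (hmN 0)]
    · congr 1
      refine Finset.sum_congr rfl fun i _ => ?_
      rw [PathConfig.fiberWeight_eq_layer (fun _ => rfl) (fun j => vertexWeight_conservative _ _)
        (fun ω hω => PathConfig.mem_obsEvent_iff_levelEvent hm'N hω)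
        (fun i => Nat.lt_succ_of_le (hL i)) hl, Nat.add_sub_cancel]
    · intro j hj
      refine Set.eq_univ_of_forall fun τ i hi => ?_
      have := hm i
      omega
    · intro τ hτ
      obtain ⟨h1, h2⟩ := hτ 0 rfl 0 (Nat.zero_le _)
      exact Bool.false_ne_true h2
    · exact fun k τ => cons_true_mem_levelEvent (fun i => hm1.trans (hm i)) hm'
  · rw [PathConfig.fiberWeight_of_not_strictAnti (mt l.strictAnti_addOnes.mp hl)]
    simp [PathConfig.fiberWeight_of_not_strictAnti hl]

theorem prod_filter_fin {M : Type*} [CommMonoid M] {N : ℕ} (p : ℕ → Prop) [DecidablePred p]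
    (F : ℕ → M) : ∏ j ∈ Finset.univ.filter fun j : Fin N => p j, F j = ∏ j ∈ Finset.range N with p j, F j := by
  rw [Finset.prod_filter, Finset.prod_filter]
  exact Fin.prod_univ_eq_prod_range (fun j => if p j then F j else 1) N

theorem sum_filter_fin {M : Type*} [AddCommMonoid M] {N : ℕ} (p : ℕ → Prop) [DecidablePred p]
    (F : ℕ → M) : ∑ j ∈ Finset.univ.filter fun j : Fin N => p j, F j = ∑ j ∈ Finset.range N with p j, F j := by
  rw [Finset.sum_filter, Finset.sum_filter]
  exact Fin.sum_univ_eq_sum_range (fun j => if p j then F j else 0) N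

theorem lemma3p7 (n k : ℕ) (hk : k + 1 ≤ n + 1) (s q : ℂ) (hs : s ≠ 0) (hq : q = (s ^ 2)⁻¹)
    (m : Fin (k + 1) → ℕ) (hm : Monotone m) (hm1 : 1 ≤ m 0) (hmN : m (Fin.last k) ≤ n + 1)
    (f : SignPos (n + 1) → ℝ)
    (U : Set (Fin (n + 1) → ℂ)) (hU : IsOpen U)
    (hsum : ∀ z ∈ U, Summable fun ω : PathConfig (n + 1) => ‖pathWeight s f z ω‖)
    (z : Fin (n + 1) → ℂ) (hz : z ∈ U) (hinj : Function.Injective z)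
    (hden : ∀ j, 1 - s * z j ≠ 0)
    (g : SignPos n → ℝ) (hg : ∀ l, g l = f l.addOnes)
    (mhat : Fin k → ℕ) (hmhat : ∀ i, mhat i = m i.succ - 1) :
    (∀ i : Fin (n + 1), (i : ℕ) < m 0 →
      Summable fun ω : PathConfig n => ‖pathWeight s g (i.removeNth z) ω‖) ∧
    obsWeight s f m z =
      (∏ j ∈ Finset.univ.filter fun j : Fin (n + 1) => m 0 ≤ (j : ℕ), (z j - s * q) / (1 - s * z j)) *
        ∑ i ∈ Finset.univ.filter fun i : Fin (n + 1) => (i : ℕ) < m 0,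
          (1 - q) / (1 - s * z i) *
            (∏ j ∈ Finset.univ.filter fun j : Fin (n + 1) => (j : ℕ) < m 0 ∧ j ≠ i,
              (z j - q * z i) / (z j - z i) * ((z j - s) / (1 - s * z j))) *
            obsWeight s g mhat (i.removeNth z) := by
  subst hq
  have hm0 : ∀ i, m 0 ≤ m i := fun i => hm (Fin.zero_le i)
  have hmN' : ∀ i, m i ≤ n + 1 := fun i => (hm (Fin.le_last i)).trans hmN
  obtain ⟨y, hyden, rfl⟩ : ∃ y : ℕ → ℂ, (∀ j, 1 - s * y j ≠ 0) ∧
      z = fun j : Fin (n + 1) => y j := by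
    -- The value 0 beyond the strip keeps the denominators `1 - s * y j` nonzero.
    refine ⟨fun j => if h : j < n + 1 then z ⟨j, h⟩ else 0, fun j => ?_, ?_⟩
    · by_cases h : j < n + 1
      · simpa only [h, dif_pos] using hden ⟨j, h⟩
      · simp [h]
    · funext j
      simp only [j.2, dif_pos]
  have hyinj : Set.InjOn y (Set.Iio (m 0)) := fun i hi j hj hij => by
    have hi' := lt_of_lt_of_le hi (hmN' 0)
    have hj' := lt_of_lt_of_le hj (hmN' 0)
    exact congrArg Fin.val (hinj (show y ((⟨i, hi'⟩ : Fin (n + 1)) : ℕ) =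
      y ((⟨j, hj'⟩ : Fin (n + 1)) : ℕ) from hij))
  simp only [removeNth_eq_skip]
  have hsummable : ∀ i, i ≤ n → Summable fun ω : PathConfig n =>
      ‖pathWeight s g (fun j : Fin n => skip i y j) ω‖ := fun i hi =>
    summable_norm_pathWeight_skip hs hU hsum hz hyden hg hi
  refine ⟨fun i _ => hsummable i (by omega), ?_⟩
  have hL := PathConfig.hasSum_fiberWeight (hsum _ hz) m
  have hR : ∀ i ∈ Finset.range (m 0), _ := fun i hi => (PathConfig.hasSum_fiberWeight
    (hsummable i (by have := hmN' 0; have := Finset.mem_range.mp hi; omega)) mhat).mul_left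
      (removalCoeff s y (m 0) i)
  have hR' := (hasSum_sum hR).mul_left
    (∏ j ∈ Finset.Ico (m 0) (n + 1), (y j - s⁻¹) / (1 - s * y j))
  -- Only signatures of the form `l.addOnes` contribute, so the left side becomes a sum over the
  -- signatures of the smaller system and can be compared termwise.
  rw [← SignPos.addOnes_injective.hasSum_iff] at hL
  · rw [hL.unique (hR'.congr_fun fun l => ?_)]
    · have h1 : ∀ i : Fin (n + 1), (1 - (s ^ 2)⁻¹) / (1 - s * y i) *
          (∏ j ∈ Finset.univ.filter fun j : Fin (n + 1) => (j : ℕ) < m 0 ∧ j ≠ i,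
            (y j - (s ^ 2)⁻¹ * y i) / (y j - y i) * ((y j - s) / (1 - s * y j))) =
          removalCoeff s y (m 0) i := by
        intro i
        rw [removalCoeff]
        congr 1
        simp only [ne_eq, Fin.ext_iff]
        rw [prod_filter_fin (fun j => j < m 0 ∧ ¬ j = i) fun j =>
          (y j - (s ^ 2)⁻¹ * y i) / (y j - y i) * ((y j - s) / (1 - s * y j))]
        refine Finset.prod_congr ?_ fun j _ => rfl
        ext j
        have := hmN' 0
        simp only [Finset.mem_filter, Finset.mem_range, Finset.mem_erase]
        omega
      have h2 : s * (s ^ 2)⁻¹ = s⁻¹ := by field_simp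
      simp only [h1, h2]
      rw [sum_filter_fin (fun i => i < m 0) fun i =>
          removalCoeff s y (m 0) i * obsWeight s g mhat fun j : Fin n => skip i y j,
        prod_filter_fin (fun j => m 0 ≤ j) fun j => (y j - s⁻¹) / (1 - s * y j)]
      congr 1
      · refine Finset.prod_congr ?_ fun j _ => rfl
        ext j
        simp only [Finset.mem_filter, Finset.mem_range, Finset.mem_Ico]
        omega
      · refine Finset.sum_congr ?_ fun j _ => rfl
        ext j
        have := hmN' 0
        simp only [Finset.mem_filter, Finset.mem_range]
        omega
    · rw [Function.comp_apply, fiberWeight_obsEvent_addOnes hs hm0 hm1 hmN' (fun j _ => hyden j)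
        hyinj hmhat, hg, mul_left_comm, Finset.mul_sum]
      congr 1
      exact Finset.sum_congr rfl fun i _ => mul_left_comm _ _ _
  · intro l hl
    rw [fiberWeight_obsEvent_eq_zero hmN' (fun ⟨l', h⟩ => hl ⟨l', h⟩), mul_zero]
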